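/- Let $\mathbb K\in\{\mathbb R,\mathbb C\}$, $A,B,C,D,E\in\mathbb K^{n\times n}$, and consider the quartic matrix polynomial $\lambda^4A+\lambda^3B+\lambda^2C+\lambda D+E$ with the $4n\times 4n$ linearization $$\mathbb A-\lambda\mathbb B=\begin{pmatrix}B&0&-I_n&0\\D&0&0&-I_n\\0&-I_n&0&0\\E&0&0&0\end{pmatrix}-\lambda\begin{pmatrix}-A&0&0&0\\-C&-I_n&0&0\\0&0&-I_n&0\\0&0&0&-I_n\end{pmatrix}.$$ All computations are done in floating point arithmetic in which every basic operation has relative error at most $\varepsilon$ (standard model). Let the Householder QR factorization with Businger--Golub column pivoting (in every step the pivot column has the largest computed norm of the remaining columns, restricted to the remaining rows) be applied to $E$; let $\widetilde\Pi_E$ be the resulting permutation, $R$ the computed $n\times n$ upper triangular factor and $\widetilde Q_E$ the explicitly formed computed unitary factor. Let $\tau$ be a threshold and $\widetilde r_E$ a numerical rank determined from a drop-off on the diagonal of $R$: $R_{ii}\ne0$ for $i\le \widetilde r_E$, and $|R_{\widetilde r_E+1,\widetilde r_E+1}|\le\tau|R_{\widetilde r_E,\widetilde r_E}|$ if $1\le\widetilde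 r_E<n$; $\widetilde r_E=0$ only if $n=0$ or $R_{11}=0$. Let $\widetilde R_E$ be the first $\widetilde r_E$ rows of $R$, so that $E\widetilde\Pi_E\approx\widetilde Q_E\left(\begin{smallmatrix}\widetilde R_E\\0\end{smallmatrix}\right)$. Let $\widetilde X=\mathrm{computed}(\widetilde Q_E^*D)$ and $\widetilde Y=\mathrm{computed}(\widetilde Q_E^*C)$, computed either by matrix multiplication with $\widetilde Q_E$ or by applying the stored Householder reflectors, and let $$\widetilde{\mathbb A}_{22}-\lambda\widetilde{\mathbb B}_{22}=\begin{pmatrix}B&0&-I_n&0\\ \widetilde X&0&0&-\left(\begin{smallmatrix}I_{\widetilde r_E}\\0\end{smallmatrix}\right)\\0&-I_n&0&0\\ \widetilde R_E\widetilde\Pi_E^T&0&0&0\end{pmatrix}-\lambda\begin{pmatrix}-A&0&0&0\\-\widetilde Y&-\widetilde Q_E^*&0&0\\0&0&-I_n&0\\0&0&0&-I_{\widetilde r_E}\end{pmatrix}$$ be the computed reduced pencil of order $3n+\widetilde r_E$. There is a constant $c>0$, independent of $n$, $\varepsilon$, $\tau$ and of all data, such that the following holds whenever $c\,n^3\varepsilon\le1$.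 Put $\epsilon=c\,n^3\varepsilon$. There exist $\delta Q_E,\delta C,\delta D,\delta E,\Delta E\in\mathbb K^{n\times n}$ such that, with $\delta\widetilde{\mathbb B}_{22}$ denoting the matrix whose only nonzero block is $-\delta Q_E^*$ at block position $(2,2)$, the pencil $\widetilde{\mathbb A}_{22}-\lambda(\widetilde{\mathbb B}_{22}+\delta\widetilde{\mathbb B}_{22})$ is an exact reduced linearization of $$\lambda^4A+\lambda^3B+\lambda^2(C+\delta C)+\lambda(D+\delta D)+(E+\delta E+\Delta E).$$ That is: $\widehat Q_E=\widetilde Q_E+\delta Q_E$ is exactly unitary, $\widetilde R_E$ is upper trapezoidal, $(E+\delta E+\Delta E)\widetilde\Pi_E=\widehat Q_E\left(\begin{smallmatrix}\widetilde R_E\\0\end{smallmatrix}\right)$ has rank exactly $\widetilde r_E$, and, if $\mathbb A'-\lambda\mathbb B'$ is the linearization above formed with the perturbed coefficients, then $$\mathrm{diag}(I_n,\widehat Q_E^*,I_n,\widehat Q_E^*)\,(\mathbb A'-\lambda\mathbb B')\,\mathrm{diag}(I_n,I_n,I_n,\widehat Q_E)=\begin{pmatrix}\widetilde{\mathbb A}_{22}-\lambda(\widetilde{\mathbb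 B}_{22}+\delta\widetilde{\mathbb B}_{22})&\ast\\0&\lambda I_{n-\widetilde r_E}\end{pmatrix}.$$ The perturbed quartic polynomial has at least $n-\widetilde r_E$ zero eigenvalues: $\lambda^{n-\widetilde r_E}$ divides its determinant, and $E+\delta E+\Delta E$ has a null space of dimension at least $n-\widetilde r_E$. Moreover $\|\delta Q_E\|_F\le\epsilon$, for all $i=1,\dots,n$ $$\|\delta C(:,i)\|_2\le\epsilon\|C(:,i)\|_2,\quad\|\delta D(:,i)\|_2\le\epsilon\|D(:,i)\|_2,\quad\|\delta E(:,i)\|_2\le\epsilon\|E(:,i)\|_2,$$ and, with $k=\widetilde r_E$, the truncation error satisfies $(\Delta E)\widetilde\Pi_E(:,1:k)=0$ and $$\|(\Delta E)\widetilde\Pi_E(:,j)\|_2\le(1+\epsilon)\,\tau\,\|(E+\delta E)\widetilde\Pi_E(:,i)\|_2\qquad(1\le i\le k<j\le n),$$ where the factor $1+\epsilon$ can be replaced by $1$ if the computed $R$ satisfies the Businger--Golub dominance $|R_{ii}|^2\ge\sum_{l=i}^{j}|R_{lj}|^2$ ($i\le j$) exactly. If $k=0$, then $\Delta E=0$. 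-/

import Mathlib

open scoped Polynomial

/-! ### Floating point arithmetic -/

/-- Standard model of floating point arithmetic: `y` is an admissible computed value of the exact
result `x` of one basic operation, i.e. its relative error is at most `ε`. -/
def Fl {K : Type*} [NormedRing K] (ε : ℝ) (x y : K) : Prop := ‖y - x‖ ≤ ε * ‖x‖

/-- `FlSum ε f s c`: `c` is an admissible computed value of the sum of `f` over the nonempty finite
set `s`, where the additions are carried out in an arbitrary order (recursive, pairwise,
blocked, ...). -/
inductive FlSum {ι K : Type*} [NormedRing K] (ε : ℝ) (f : ι → K) : Finset ι → K → Prop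
  | single (i : ι) : FlSum ε f {i} (f i)
  | add {s t : Finset ι} {a b c : K} (hst : Disjoint s t) (hs : FlSum ε f s a)
      (ht : FlSum ε f t b) (hc : Fl ε (a + b) c) : FlSum ε f (s.disjUnion t hst) c

/-- `c` is an admissible computed value of the sum of `a i * b i` over `i ∈ s`. -/
def FlDot {ι K : Type*} [NormedRing K] (ε : ℝ) (s : Finset ι) (a b : ι → K) (c : K) : Prop :=
  ∃ p : ι → K, (∀ i ∈ s, Fl ε (a i * b i) (p i)) ∧ FlSum ε p s c

/-- `ν` is an admissible computed value of the Euclidean norm of the entries `x i`, `i ∈ s`. -/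
def FlNorm {ι 𝕜 : Type*} [RCLike 𝕜] (ε : ℝ) (s : Finset ι) (x : ι → 𝕜) (ν : ℝ) : Prop :=
  ∃ (q : ι → ℝ) (t : ℝ), (∀ i ∈ s, Fl ε (‖x i‖ ^ 2) (q i)) ∧ FlSum ε q s t ∧ Fl ε (Real.sqrt t) ν

/-! ### Householder QR factorization with column pivoting in floating point arithmetic -/

section Householder

variable {𝕜 : Type*} [RCLike 𝕜] {n : ℕ}

/-- Computation of a Householder reflector `H = I - β v v^*` that acts on the rows `k, k+1, ...` and
maps (in exact arithmetic) the rows `k, k+1, ...` of `x` to `(-σ, 0, ..., 0)`, where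
`σ = (x k / |x k|) ‖x(k:n)‖`, `v = x(k:n) + σ e_k` and `β = 1 / (‖x(k:n)‖ (‖x(k:n)‖ + |x k|))`.
Here `ν` is the already computed norm of `x(k:n)`. -/
def FlReflector (ε : ℝ) (k : Fin n) (x : Fin n → 𝕜) (ν : ℝ) (σ : 𝕜) (v : Fin n → 𝕜) (β : ℝ) :
    Prop :=
  (ν = 0 → σ = 0 ∧ v = 0 ∧ β = 0) ∧
  (ν ≠ 0 →
    (∀ i, i < k → v i = 0) ∧ (∀ i, k < i → v i = x i) ∧ Fl ε (x k + σ) (v k) ∧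
    ∃ (a : ℝ) (φ : 𝕜) (d b : ℝ),
      Fl ε ‖x k‖ a ∧
      (x k = 0 → φ = 1) ∧ (x k ≠ 0 → Fl ε (x k / (a : 𝕜)) φ) ∧
      Fl ε (φ * (ν : 𝕜)) σ ∧
      Fl ε (ν + a) d ∧ Fl ε (ν * d) b ∧ Fl ε (1 / b) β)

/-- `y'` is an admissible computed value of `(I - β v v^*) y`, evaluated on the rows `k, k+1, ...`
as `y - v (β (v^* y))`; the rows above row `k` are not touched. -/
def FlReflect (ε : ℝ) (k : Fin n) (v : Fin n → 𝕜) (β : ℝ) (y y' : Fin n → 𝕜) : Prop :=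
  (∀ i, i < k → y' i = y i) ∧
  ∃ w g : 𝕜, FlDot ε (Finset.Ici k) (fun i => star (v i)) y w ∧ Fl ε ((β : 𝕜) * w) g ∧
    ∀ i, k ≤ i → ∃ p : 𝕜, Fl ε (v i * g) p ∧ Fl ε (y i - p) (y' i)

/-- Householder QR factorization with (Businger--Golub) column pivoting of `E`, in floating point
arithmetic. The column interchanges are collected in the permutation `π`: column `j` of `E Π` is
column `π j` of `E`. In step `k` the pivot column `k` has the largest computed norm of all
remaining columns (restricted to the rows `k, k+1, ...`). `W k` is the working array before step
`k`, the reflectors are given by `v k`, `β k`, and `R` is the final upper triangular array. -/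
def IsPivotedQR (ε : ℝ) (E : Matrix (Fin n) (Fin n) 𝕜) (π : Equiv.Perm (Fin n))
    (v : Fin n → Fin n → 𝕜) (β : Fin n → ℝ) (R : Matrix (Fin n) (Fin n) 𝕜) : Prop :=
  ∃ (W : ℕ → Matrix (Fin n) (Fin n) 𝕜) (ν : Fin n → Fin n → ℝ) (σ : Fin n → 𝕜),
    W 0 = E.submatrix id π ∧ W n = R ∧
    ∀ k : Fin n,
      (∀ j, k ≤ j → FlNorm ε (Finset.Ici k) (fun i => W k i j) (ν k j)) ∧
      (∀ j, k ≤ j → ν k j ≤ ν k k) ∧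
      FlReflector ε k (fun i => W k i k) (ν k k) (σ k) (v k) (β k) ∧
      (∀ j, j < k → ∀ i, W (k + 1) i j = W k i j) ∧
      (∀ i, W (k + 1) i k = if i < k then W k i k else if i = k then -σ k else 0) ∧
      (∀ j, k < j → FlReflect ε k (v k) (β k) (fun i => W k i j) (fun i => W (k + 1) i j))

/-- `Q` is the explicitly formed computed unitary factor: the reflectors are accumulated backwards,
`Q = H_1 (H_2 (... (H_n I)))`. -/
def IsFormedQ (ε : ℝ) (v : Fin n → Fin n → 𝕜) (β : Fin n → ℝ) (Q : Matrix (Fin n) (Fin n) 𝕜) :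
    Prop :=
  ∃ G : ℕ → Matrix (Fin n) (Fin n) 𝕜, G n = 1 ∧ G 0 = Q ∧
    ∀ k j : Fin n, FlReflect ε k (v k) (β k) (fun i => G (k + 1) i j) (fun i => G k i j)

/-- `X` is computed as `Q^* D` by matrix multiplication with the explicitly formed `Q`. -/
def IsMatMulProduct (ε : ℝ) (Q D X : Matrix (Fin n) (Fin n) 𝕜) : Prop :=
  ∀ i j, FlDot ε Finset.univ (fun l => star (Q l i)) (fun l => D l j) (X i j)

/-- `X` is computed as `Q^* D = H_n (... (H_2 (H_1 D)))` by applying the stored reflectors. -/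
def IsReflectorProduct (ε : ℝ) (v : Fin n → Fin n → 𝕜) (β : Fin n → ℝ)
    (D X : Matrix (Fin n) (Fin n) 𝕜) : Prop :=
  ∃ Z : ℕ → Matrix (Fin n) (Fin n) 𝕜, Z 0 = D ∧ Z n = X ∧
    ∀ k j : Fin n, FlReflect ε k (v k) (β k) (fun i => Z k i j) (fun i => Z (k + 1) i j)

/-- `X = computed(Q^* D)`, with `Q` used either explicitly or through its reflectors. -/
def IsComputedProduct (ε : ℝ) (v : Fin n → Fin n → 𝕜) (β : Fin n → ℝ)
    (Q D X : Matrix (Fin n) (Fin n) 𝕜) : Prop :=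
  IsMatMulProduct ε Q D X ∨ IsReflectorProduct ε v β D X

/-- `r` is a numerical rank of the computed triangular factor `R`, with threshold `τ`: the first `r`
diagonal entries do not vanish and, unless `r = n`, there is a drop-off `|R_{r+1,r+1}| ≤ τ |R_{rr}|`
between two consecutive diagonal entries (one-based indices). The value `r = 0` is allowed only if
already the first diagonal entry is zero. -/
def IsNumericalRank (τ : ℝ) (R : Matrix (Fin n) (Fin n) 𝕜) (r : ℕ) : Prop :=
  r ≤ n ∧ (∀ i : Fin n, (i : ℕ) < r → R i i ≠ 0) ∧
  (∀ i j : Fin n, (i : ℕ) + 1 = r → (j : ℕ) = r → ‖R j j‖ ≤ τ * ‖R i i‖) ∧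
  (r = 0 → ∀ j : Fin n, (j : ℕ) = 0 → R j j = 0)

/-- Exact diagonal dominance of Businger--Golub type:
`|R_{ii}| ≥ (∑_{l=i}^{j} |R_{lj}|^2)^{1/2}` for `i ≤ j`. -/
def IsDiagDominant (R : Matrix (Fin n) (Fin n) 𝕜) : Prop :=
  ∀ i j, i ≤ j → ∑ l ∈ Finset.Icc i j, ‖R l j‖ ^ 2 ≤ ‖R i i‖ ^ 2

end Householder

/-! ### The linearization of the quartic polynomial and its first deflation step -/

section Pencils

variable {𝕜 : Type*} [RCLike 𝕜] {n r : ℕ}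

/-- Euclidean norm of column `j`. -/
noncomputable def colNorm (M : Matrix (Fin n) (Fin n) 𝕜) (j : Fin n) : ℝ :=
  Real.sqrt (∑ i, ‖M i j‖ ^ 2)

/-- Frobenius norm. -/
noncomputable def frobNorm (M : Matrix (Fin n) (Fin n) 𝕜) : ℝ :=
  Real.sqrt (∑ i, ∑ j, ‖M i j‖ ^ 2)

/-- The matrix polynomial `λ^4 A + λ^3 B + λ^2 C + λ D + E`. -/
noncomputable def quartic (A B C D E : Matrix (Fin n) (Fin n) 𝕜) : Matrix (Fin n) (Fin n) 𝕜[X] :=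
  (Polynomial.X ^ 4 : 𝕜[X]) • A.map Polynomial.C + (Polynomial.X ^ 3 : 𝕜[X]) • B.map Polynomial.C
    + (Polynomial.X ^ 2 : 𝕜[X]) • C.map Polynomial.C + (Polynomial.X : 𝕜[X]) • D.map Polynomial.C + E.map Polynomial.C

/-- The matrix polynomial `P` has at least `m` zero eigenvalues, counted with algebraic multiplicity
(`λ^m` divides `det P(λ)`) and also counted with geometric multiplicity
(the null space of `P(0)` has dimension at least `m`). -/
def HasAtLeastZeroEigenvalues (m : ℕ) (P : Matrix (Fin n) (Fin n) 𝕜[X]) : Prop :=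
  (Polynomial.X : 𝕜[X]) ^ m ∣ P.det ∧
  m ≤ Module.finrank 𝕜 (LinearMap.ker (Matrix.toLin' (P.map (Polynomial.eval 0))))

/-- The left coefficient `𝔸` of the `4n × 4n` linearization `𝔸 - λ 𝔹`. -/
def linA (B D E : Matrix (Fin n) (Fin n) 𝕜) :
    Matrix ((Fin n ⊕ Fin n) ⊕ (Fin n ⊕ Fin n)) ((Fin n ⊕ Fin n) ⊕ (Fin n ⊕ Fin n)) 𝕜 :=
  Matrix.fromBlocks (Matrix.fromBlocks B 0 D 0) (-1) (Matrix.fromBlocks 0 (-1) E 0) 0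

/-- The right coefficient `𝔹` of the `4n × 4n` linearization `𝔸 - λ 𝔹`. -/
def linB (A C : Matrix (Fin n) (Fin n) 𝕜) :
    Matrix ((Fin n ⊕ Fin n) ⊕ (Fin n ⊕ Fin n)) ((Fin n ⊕ Fin n) ⊕ (Fin n ⊕ Fin n)) 𝕜 :=
  Matrix.fromBlocks (Matrix.fromBlocks (-A) 0 (-C) (-1)) 0 0 (-1)

/-- The left transformation `diag(I, Q^*, I, Q^*)`. -/
def transL (Q : Matrix (Fin n) (Fin n) 𝕜) :
    Matrix ((Fin n ⊕ Fin n) ⊕ (Fin n ⊕ Fin n)) ((Fin n ⊕ Fin n) ⊕ (Fin n ⊕ Fin n)) 𝕜 :=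
  Matrix.fromBlocks (Matrix.fromBlocks 1 0 0 Q.conjTranspose) 0 0
    (Matrix.fromBlocks 1 0 0 Q.conjTranspose)

/-- The right transformation `diag(I, I, I, Q)`. -/
def transR (Q : Matrix (Fin n) (Fin n) 𝕜) :
    Matrix ((Fin n ⊕ Fin n) ⊕ (Fin n ⊕ Fin n)) ((Fin n ⊕ Fin n) ⊕ (Fin n ⊕ Fin n)) 𝕜 :=
  Matrix.fromBlocks 1 0 0 (Matrix.fromBlocks 1 0 0 Q)

/-- The `n × r` matrix formed by the first `r` columns of the identity. -/
def firstCols (𝕜 : Type*) [RCLike 𝕜] (h : r ≤ n) : Matrix (Fin n) (Fin r) 𝕜 :=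
  (1 : Matrix (Fin n) (Fin n) 𝕜).submatrix id (Fin.castLE h)

/-- The first `r` rows of `R`. -/
def firstRows (h : r ≤ n) (R : Matrix (Fin n) (Fin n) 𝕜) : Matrix (Fin r) (Fin n) 𝕜 :=
  R.submatrix (Fin.castLE h) id

/-- The left coefficient of the reduced pencil of order `3n + r`, with blocks `B`, `X` (in exact
arithmetic `Q^* D`) and `R Π^T`. -/
def redA (h : r ≤ n) (B X : Matrix (Fin n) (Fin n) 𝕜) (R : Matrix (Fin r) (Fin n) 𝕜)
    (π : Equiv.Perm (Fin n)) :
    Matrix ((Fin n ⊕ Fin n) ⊕ (Fin n ⊕ Fin r)) ((Fin n ⊕ Fin n) ⊕ (Fin n ⊕ Fin r)) 𝕜 :=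
  Matrix.fromBlocks (Matrix.fromBlocks B 0 X 0)
    (Matrix.fromBlocks (-1) 0 0 (-firstCols 𝕜 h))
    (Matrix.fromBlocks 0 (-1) (R.submatrix id π.symm) 0) 0

/-- The right coefficient of the reduced pencil of order `3n + r`, with blocks `-A`, `-Y` (in exact
arithmetic `-Q^* C`) and `-Q^*`. -/
def redB (r : ℕ) (A Y Q : Matrix (Fin n) (Fin n) 𝕜) :
    Matrix ((Fin n ⊕ Fin n) ⊕ (Fin n ⊕ Fin r)) ((Fin n ⊕ Fin n) ⊕ (Fin n ⊕ Fin r)) 𝕜 :=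
  Matrix.fromBlocks (Matrix.fromBlocks (-A) 0 (-Y) (-Q.conjTranspose)) 0 0 (-1)

/-- The structured perturbation of the right coefficient: the only nonzero block is `-δQ^*`. -/
def deltaRedB (r : ℕ) (δQ : Matrix (Fin n) (Fin n) 𝕜) :
    Matrix ((Fin n ⊕ Fin n) ⊕ (Fin n ⊕ Fin r)) ((Fin n ⊕ Fin n) ⊕ (Fin n ⊕ Fin r)) 𝕜 :=
  Matrix.fromBlocks (Matrix.fromBlocks 0 0 0 (-δQ.conjTranspose)) 0 0 0

/-- Splitting the `4n` indices into the leading `3n + r` and the trailing `n - r` ones. -/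
def splitIdx (h : r ≤ n) :
    ((Fin n ⊕ Fin n) ⊕ (Fin n ⊕ Fin r)) ⊕ Fin (n - r) ≃ (Fin n ⊕ Fin n) ⊕ (Fin n ⊕ Fin n) :=
  (Equiv.sumAssoc _ _ _).trans ((Equiv.refl _).sumCongr ((Equiv.sumAssoc _ _ _).trans
    ((Equiv.refl _).sumCongr (finSumFinEquiv.trans (finCongr (Nat.add_sub_of_le h))))))

/-- `𝔸₂ - λ 𝔹₂` is an exact reduced linearization, of order `3n + r`, of the quartic polynomial with
coefficients `A, B, C, D, E`: for an exact QR factorization with column permutation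
`E Π = Q (R; 0)`, where `Q` is unitary, `R` is `r × n` upper trapezoidal and `r = rank E`, the
transformed linearization `diag(I, Q^*, I, Q^*) (𝔸 - λ 𝔹) diag(I, I, I, Q)` is block upper
triangular, with leading diagonal block `𝔸₂ - λ 𝔹₂` and with trailing diagonal block
`-λ (-I)` of order `n - r` (which carries the deflated `n - r` zero eigenvalues). -/
def IsExactReducedLinearization (h : r ≤ n) (A B C D E : Matrix (Fin n) (Fin n) 𝕜)
    (π : Equiv.Perm (Fin n)) (Q : Matrix (Fin n) (Fin n) 𝕜) (R : Matrix (Fin r) (Fin n) 𝕜)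
    (A₂ B₂ : Matrix ((Fin n ⊕ Fin n) ⊕ (Fin n ⊕ Fin r)) ((Fin n ⊕ Fin n) ⊕ (Fin n ⊕ Fin r)) 𝕜) :
    Prop :=
  Q ∈ Matrix.unitaryGroup (Fin n) 𝕜 ∧
  (∀ (i : Fin r) (j : Fin n), (j : ℕ) < (i : ℕ) → R i j = 0) ∧
  E.rank = r ∧
  E.submatrix id π = Q * (firstCols 𝕜 h * R) ∧
  ∃ S T : Matrix ((Fin n ⊕ Fin n) ⊕ (Fin n ⊕ Fin r)) (Fin (n - r)) 𝕜,
    (transL Q * linA B D E * transR Q).submatrix (splitIdx h) (splitIdx h)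
      = Matrix.fromBlocks A₂ S 0 0 ∧
    (transL Q * linB A C * transR Q).submatrix (splitIdx h) (splitIdx h)
      = Matrix.fromBlocks B₂ T 0 (-1)

end Pencils

/-!
Every computed reflector is close to the exact reflection `P k` in the hyperplane orthogonal to
the exact Householder vector of the current array, and `P k` is unitary regardless of the rounding
errors made before. Hence one exact unitary matrix `U = P 0 * P 1 * ⋯` explains, up to `O(n ^ 3)`
roundings per column, the computed triangular factor, the formed factor `Q` and all products
computed with either of them. Setting the rows of `R` below the numerical rank to zero is the only
truncation; column pivoting keeps it below the drop-off, because the computed `R` inherits the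
Businger–Golub dominance up to `O(n ^ 2)` roundings. With `U` exactly unitary the deflation is
exact.
-/

open scoped InnerProductSpace

section Rounding

variable {V W : Type*} [SeminormedAddCommGroup V] [SeminormedAddCommGroup W]
  {k l : ℕ} {ε M N : ℝ}

/-- `x'` is obtained from `x` through the accumulated effect of `k` roundings, measured relative to
a scale `M` that dominates `‖x‖`. Taking `(1 + ε) ^ k - 1` as the error bound makes the numbers of
roundings of consecutive operations add up exactly. -/
def FlWithin (ε : ℝ) (k : ℕ) (M : ℝ) (x x' : V) : Prop :=
  ‖x‖ ≤ M ∧ ‖x' - x‖ ≤ ((1 + ε) ^ k - 1) * M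

theorem one_add_pow_sub_one_nonneg (hε : 0 ≤ ε) (k : ℕ) : 0 ≤ (1 + ε) ^ k - 1 :=
  sub_nonneg.2 (one_le_pow₀ (le_add_of_nonneg_right hε))

theorem one_add_pow_mono (hε : 0 ≤ ε) (hkl : k ≤ l) : (1 + ε) ^ k ≤ (1 + ε) ^ l :=
  pow_le_pow_right₀ (le_add_of_nonneg_right hε) hkl

theorem mul_one_add_pow_sub_one_le (hε : 0 ≤ ε) (m k : ℕ) :
    m * ((1 + ε) ^ k - 1) ≤ (1 + ε) ^ (m * k) - 1 := by
  have bernoulli := one_add_mul_le_pow (a := (1 + ε) ^ k - 1)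
    (by linarith [one_add_pow_sub_one_nonneg hε k]) m
  rw [add_sub_cancel, ← pow_mul, mul_comm k] at bernoulli
  linarith

namespace FlWithin

variable {x x' x'' y y' : V}

theorem refl (hε : 0 ≤ ε) (k : ℕ) (hx : ‖x‖ ≤ M) : FlWithin ε k M x x :=
  ⟨hx, by
    simpa using mul_nonneg (one_add_pow_sub_one_nonneg hε k) ((norm_nonneg x).trans hx)⟩

theorem scale_nonneg (h : FlWithin ε k M x x') : 0 ≤ M :=
  (norm_nonneg x).trans h.1

theorem norm_le (h : FlWithin ε k M x x') : ‖x'‖ ≤ (1 + ε) ^ k * M := by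
  have := norm_le_norm_add_norm_sub' x' x
  linarith [h.1, h.2]

theorem mono (hε : 0 ≤ ε) (h : FlWithin ε k M x x') (hk : k ≤ l) : FlWithin ε l M x x' :=
  ⟨h.1, h.2.trans <| mul_le_mul_of_nonneg_right
    (sub_le_sub_right (one_add_pow_mono hε hk) 1) h.scale_nonneg⟩

theorem mono_scale (hε : 0 ≤ ε) (h : FlWithin ε k M x x') (hM : M ≤ N) : FlWithin ε k N x x' :=
  ⟨h.1.trans hM, h.2.trans <|
    mul_le_mul_of_nonneg_left hM (one_add_pow_sub_one_nonneg hε k)⟩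

theorem trans (hε : 0 ≤ ε) (h : FlWithin ε k M x x') (h' : FlWithin ε l N x' x'')
    (hN : N ≤ (1 + ε) ^ k * M) : FlWithin ε (k + l) M x x'' :=
  ⟨h.1, calc
    ‖x'' - x‖ ≤ ‖x'' - x'‖ + ‖x' - x‖ := norm_sub_le_norm_sub_add_norm_sub ..
    _ ≤ ((1 + ε) ^ l - 1) * ((1 + ε) ^ k * M) + ((1 + ε) ^ k - 1) * M :=
      add_le_add (h'.2.trans <|
        mul_le_mul_of_nonneg_left hN (one_add_pow_sub_one_nonneg hε l)) h.2
    _ = ((1 + ε) ^ (k + l) - 1) * M := by ring⟩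

theorem of_norm_sub_le (h : ‖x' - x‖ ≤ ε * ‖x‖) : FlWithin ε 1 ‖x‖ x x' :=
  ⟨le_rfl, by simpa using h⟩

theorem round (hε : 0 ≤ ε) (h : FlWithin ε k M x x') (h' : ‖x'' - x'‖ ≤ ε * ‖x'‖) :
    FlWithin ε (k + 1) M x x'' :=
  h.trans hε (of_norm_sub_le h') h.norm_le

theorem add (h : FlWithin ε k M x x') (h' : FlWithin ε k N y y') :
    FlWithin ε k (M + N) (x + y) (x' + y') :=
  ⟨norm_add_le_of_le h.1 h'.1, by
    rw [add_sub_add_comm, mul_add]; exact norm_add_le_of_le h.2 h'.2⟩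

theorem sub (h : FlWithin ε k M x x') (h' : FlWithin ε k N y y') :
    FlWithin ε k (M + N) (x - y) (x' - y') :=
  ⟨norm_sub_le_of_le h.1 h'.1, by
    rw [sub_sub_sub_comm, mul_add]; exact norm_sub_le_of_le h.2 h'.2⟩

theorem sum {ι : Type*} {s : Finset ι} {f g : ι → V} {M : ι → ℝ}
    (h : ∀ i ∈ s, FlWithin ε k (M i) (f i) (g i)) :
    FlWithin ε k (∑ i ∈ s, M i) (∑ i ∈ s, f i) (∑ i ∈ s, g i) :=
  ⟨norm_sum_le_of_le s fun i hi => (h i hi).1, by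
    rw [← Finset.sum_sub_distrib, Finset.mul_sum]
    exact norm_sum_le_of_le s fun i hi => (h i hi).2⟩

/-- Bernoulli's inequality trades a factor of the scale for a multiple of the roundings. -/
theorem scale (hε : 0 ≤ ε) {m : ℕ} (h : FlWithin ε k (m * M) x x') (hx : ‖x‖ ≤ M) :
    FlWithin ε (m * k) M x x' := by
  refine ⟨hx, h.2.trans ?_⟩
  rw [← mul_assoc, mul_comm _ (m : ℝ)]
  exact mul_le_mul_of_nonneg_right (mul_one_add_pow_sub_one_le hε m k)
    ((norm_nonneg x).trans hx)

theorem smul {K : Type*} [SeminormedRing K] [Module K V] [IsBoundedSMul K V] {a a' : K}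
    (ha : FlWithin ε k M a a') (hx : FlWithin ε l N x x') :
    FlWithin ε (k + l) (M * N) (a • x) (a' • x') := by
  refine ⟨(norm_smul_le a x).trans (mul_le_mul ha.1 hx.1 (norm_nonneg _) ha.scale_nonneg), ?_⟩
  calc ‖a' • x' - a • x‖ = ‖(a' - a) • x' + a • (x' - x)‖ := by
        rw [sub_smul, smul_sub, sub_add_sub_cancel]
    _ ≤ ((1 + ε) ^ k - 1) * M * ((1 + ε) ^ l * N) + M * (((1 + ε) ^ l - 1) * N) :=
      norm_add_le_of_le
        ((norm_smul_le _ _).trans <| mul_le_mul ha.2 hx.norm_le (norm_nonneg _) <|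
          (norm_nonneg _).trans ha.2)
        ((norm_smul_le _ _).trans <| mul_le_mul ha.1 hx.2 (norm_nonneg _) ha.scale_nonneg)
    _ = ((1 + ε) ^ (k + l) - 1) * (M * N) := by ring

theorem mul {K : Type*} [SeminormedRing K] {a a' b b' : K}
    (ha : FlWithin ε k M a a') (hb : FlWithin ε l N b b') :
    FlWithin ε (k + l) (M * N) (a * b) (a' * b') :=
  ha.smul hb

theorem inner_left {𝕜 E : Type*} [RCLike 𝕜] [SeminormedAddCommGroup E] [InnerProductSpace 𝕜 E]
    {u u' : E} (h : FlWithin ε k M u u') (y : E) :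
    FlWithin ε k (M * ‖y‖) (inner 𝕜 u y) (inner 𝕜 u' y) :=
  ⟨(norm_inner_le_norm u y).trans (mul_le_mul_of_nonneg_right h.1 (norm_nonneg y)), by
    rw [← inner_sub_left, ← mul_assoc]
    exact (norm_inner_le_norm _ y).trans (mul_le_mul_of_nonneg_right h.2 (norm_nonneg y))⟩

theorem ofReal (𝕜 : Type*) [RCLike 𝕜] {x x' : ℝ} (h : FlWithin ε k M x x') :
    FlWithin ε k M (x : 𝕜) (x' : 𝕜) := by
  simpa only [FlWithin, ← RCLike.ofReal_sub, RCLike.norm_ofReal, Real.norm_eq_abs] using h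

theorem map {𝕜 : Type*} [NormedField 𝕜] [NormedSpace 𝕜 V] [NormedSpace 𝕜 W]
    (f : V ≃ₗᵢ[𝕜] W) (h : FlWithin ε k M x x') : FlWithin ε k M (f x) (f x') :=
  ⟨by simpa using h.1, by simpa only [← map_sub, f.norm_map] using h.2⟩

theorem le_norm (hε : 0 ≤ ε) (h : FlWithin ε k M x x') (hM : M ≤ ‖x‖)
    (hk : (1 + ε) ^ k ≤ 3 / 2) : M ≤ (1 + ε) ^ (2 * k) * ‖x'‖ := by
  have h₀ := one_add_pow_sub_one_nonneg hε k
  have lower : M - ‖x'‖ ≤ ((1 + ε) ^ k - 1) * M := by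
    linarith [h.2, norm_sub_norm_le x x', norm_sub_rev x x']
  rw [mul_comm 2, pow_mul]
  generalize (1 + ε) ^ k = a at *
  have : 1 ≤ a ^ 2 * (2 - a) := by
    linarith [mul_nonneg h₀ (show 0 ≤ a + 1 - a ^ 2 by nlinarith)]
  calc M ≤ a ^ 2 * (2 - a) * M := le_mul_of_one_le_left h.scale_nonneg this
    _ ≤ a ^ 2 * ‖x'‖ := by rw [mul_assoc]; gcongr; linarith

theorem inv {K : Type*} [NormedField K] {x y : K} (hε : 0 ≤ ε) (h : FlWithin ε k M x y)
    (hM : M ≤ ‖x‖) (hk : (1 + ε) ^ k ≤ 3 / 2) : FlWithin ε (2 * k) M⁻¹ x⁻¹ y⁻¹ := by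
  have h₀ := one_add_pow_sub_one_nonneg hε k
  have lower := h.le_norm hε hM hk
  obtain rfl : M = ‖x‖ := hM.antisymm h.1
  rcases eq_or_ne x 0 with rfl | hx
  · obtain rfl : y = 0 := by simpa using h.norm_le
    exact refl hε _ (norm_inv _).le
  have hy : y ≠ 0 := by rintro rfl; simp [hx] at lower
  refine ⟨(norm_inv x).le, ?_⟩
  rw [inv_sub_inv hy hx, norm_div, norm_sub_rev, norm_mul, ← div_eq_mul_inv,
    div_le_div_iff₀ (by positivity) (by positivity)]
  rw [mul_comm 2, pow_mul] at lower ⊢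
  have error := h.2
  generalize (1 + ε) ^ k = a at *
  have : (a - 1) * a ^ 2 ≤ a ^ 2 - 1 := by
    linarith [mul_nonneg h₀ (show 0 ≤ a + 1 - a ^ 2 by nlinarith)]
  calc ‖y - x‖ * ‖x‖ ≤ (a - 1) * ‖x‖ * (a ^ 2 * ‖y‖) := by gcongr
    _ = (a - 1) * a ^ 2 * (‖y‖ * ‖x‖) := by ring
    _ ≤ (a ^ 2 - 1) * (‖y‖ * ‖x‖) := by gcongr

theorem sqrt {S t : ℝ} (h : FlWithin ε k S S t) : FlWithin ε k √S √S √t := by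
  have hS := h.scale_nonneg
  refine ⟨(Real.norm_of_nonneg (Real.sqrt_nonneg S)).le, ?_⟩
  have key : ‖√t - √S‖ * √S ≤ ‖t - S‖ := by
    rcases le_total t 0 with ht | ht
    · rw [Real.sqrt_eq_zero'.2 ht, zero_sub, norm_neg, Real.norm_of_nonneg (Real.sqrt_nonneg S),
        Real.mul_self_sqrt hS, norm_sub_rev]
      exact (le_sub_self_iff S).2 ht |>.trans (le_abs_self _)
    · calc ‖√t - √S‖ * √S ≤ ‖√t - √S‖ * ‖√t + √S‖ := by
            rw [Real.norm_of_nonneg (by positivity : 0 ≤ √t + √S)]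
            gcongr
            exact le_add_of_nonneg_left (Real.sqrt_nonneg t)
        _ = ‖t - S‖ := by
            rw [← norm_mul]; congr 1; linear_combination Real.sq_sqrt ht - Real.sq_sqrt hS
  rcases hS.eq_or_lt with rfl | hS
  · have : t = 0 := by simpa using h.2
    simp [this]
  · refine le_of_mul_le_mul_right ((key.trans h.2).trans_eq ?_) (Real.sqrt_pos.2 hS)
    rw [mul_assoc, Real.mul_self_sqrt hS.le]

end FlWithin

end Rounding

section Summation

variable {ι K 𝕜 : Type*} [NormedRing K] [RCLike 𝕜] {s : Finset ι} {k : ℕ} {ε : ℝ}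

theorem Fl.flWithin {x y : K} (h : Fl ε x y) : FlWithin ε 1 ‖x‖ x y :=
  FlWithin.of_norm_sub_le h

theorem FlSum.nonempty {f : ι → K} {c : K} (h : FlSum ε f s c) : s.Nonempty := by
  induction h with
  | single i => exact Finset.singleton_nonempty i
  | add _ _ _ _ ihs _ => exact ihs.imp fun i hi => Finset.mem_disjUnion.2 (.inl hi)

theorem FlSum.flWithin (hε : 0 ≤ ε) {f g : ι → K} {M : ι → ℝ} {c : K} (h : FlSum ε g s c)
    (hg : ∀ i ∈ s, FlWithin ε k (M i) (f i) (g i)) :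
    FlWithin ε (k + (s.card - 1)) (∑ i ∈ s, M i) (∑ i ∈ s, f i) c := by
  induction h with
  | single i => simpa using hg i (by simp)
  | @add s t a b c hst hs ht hc ihs iht =>
    have hs' := hs.nonempty.card_pos
    have ht' := ht.nonempty.card_pos
    simp only [Finset.mem_disjUnion] at hg
    rw [Finset.sum_disjUnion, Finset.sum_disjUnion, Finset.card_disjUnion]
    have ha := (ihs fun i hi => hg i (.inl hi)).mono hε
      (show _ ≤ k + (s.card + t.card - 2) by omega)
    have hb := (iht fun i hi => hg i (.inr hi)).mono hε
      (show _ ≤ k + (s.card + t.card - 2) by omega)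
    exact ((ha.add hb).round hε hc).mono hε (by omega)

theorem FlDot.flWithin (hε : 0 ≤ ε) {a a' b b' : ι → K} {M N : ι → ℝ} {c : K} {l : ℕ}
    (h : FlDot ε s a' b' c) (ha : ∀ i ∈ s, FlWithin ε k (M i) (a i) (a' i))
    (hb : ∀ i ∈ s, FlWithin ε l (N i) (b i) (b' i)) :
    FlWithin ε (k + l + s.card) (∑ i ∈ s, M i * N i) (∑ i ∈ s, a i * b i) c := by
  obtain ⟨p, hp, hc⟩ := h
  have hs := hc.nonempty.card_pos
  exact (hc.flWithin hε fun i hi => ((ha i hi).mul (hb i hi)).round hε (hp i hi)).mono hε (by omega)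

theorem FlNorm.flWithin (hε : 0 ≤ ε) {x : ι → 𝕜} {ν : ℝ} (h : FlNorm ε s x ν) :
    FlWithin ε (s.card + 1) √(∑ i ∈ s, ‖x i‖ ^ 2) √(∑ i ∈ s, ‖x i‖ ^ 2) ν := by
  obtain ⟨q, t, hq, ht, hν⟩ := h
  have hexact : ∀ i ∈ s, FlWithin ε 0 ‖x i‖ ‖x i‖ ‖x i‖ := fun i _ =>
    .refl hε 0 (norm_norm (x i)).le
  have hdot : FlDot ε s (fun i => ‖x i‖) (fun i => ‖x i‖) t := ⟨q, by simpa only [sq] using hq, ht⟩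
  have hsum := hdot.flWithin hε hexact hexact
  simp only [zero_add, ← sq] at hsum
  exact hsum.sqrt.round hε hν

theorem FlNorm.nonneg (hε : ε ≤ 1) {x : ι → 𝕜} {ν : ℝ} (h : FlNorm ε s x ν) : 0 ≤ ν := by
  obtain ⟨q, t, -, -, hν⟩ := h
  have : |ν - √t| ≤ ε * |√t| := hν
  rw [abs_of_nonneg (Real.sqrt_nonneg t)] at this
  nlinarith [neg_abs_le (ν - √t), Real.sqrt_nonneg t]

end Summation

section Columns

variable {ι 𝕜 : Type*} [RCLike 𝕜] {k : ℕ} {ε M : ℝ}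

/-- The column `x` with the entries outside the rows `S` replaced by zero, as a vector of the
Euclidean space; `S = Set.univ` is the whole column. -/
noncomputable def restrictRows (S : Set ι) (x : ι → 𝕜) : EuclideanSpace 𝕜 ι :=
  WithLp.toLp 2 (S.indicator x)

theorem restrictRows_apply_of_mem {S : Set ι} {i : ι} (hi : i ∈ S) (x : ι → 𝕜) :
    restrictRows S x i = x i :=
  Set.indicator_of_mem hi x

theorem restrictRows_apply_of_notMem {S : Set ι} {i : ι} (hi : i ∉ S) (x : ι → 𝕜) :
    restrictRows S x i = 0 :=
  Set.indicator_of_notMem hi x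

theorem restrictRows_univ (x : ι → 𝕜) : restrictRows Set.univ x = WithLp.toLp 2 x := by
  rw [restrictRows, Set.indicator_univ]

variable [Fintype ι]

theorem norm_restrictRows_coe (s : Finset ι) (x : ι → 𝕜) :
    ‖restrictRows (s : Set ι) x‖ = √(∑ i ∈ s, ‖x i‖ ^ 2) := by
  rw [EuclideanSpace.norm_eq, ← Finset.sum_subset s.subset_univ fun i _ hi => by
    rw [restrictRows_apply_of_notMem (by simpa using hi), norm_zero, zero_pow two_ne_zero]]
  exact congrArg _ (Finset.sum_congr rfl fun i hi => by
    rw [restrictRows_apply_of_mem (Finset.mem_coe.2 hi)])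

theorem norm_apply_le_norm_restrictRows {S : Set ι} {i : ι} (hi : i ∈ S) (x : ι → 𝕜) :
    ‖x i‖ ≤ ‖restrictRows S x‖ :=
  (congrArg norm (restrictRows_apply_of_mem hi x)).ge.trans (PiLp.norm_apply_le _ i)

theorem euclidean_norm_le_mul {c : ℝ} (hc : 0 ≤ c) {x y : EuclideanSpace 𝕜 ι}
    (h : ∀ i, ‖x i‖ ≤ c * ‖y i‖) : ‖x‖ ≤ c * ‖y‖ := by
  rw [EuclideanSpace.norm_eq, EuclideanSpace.norm_eq]
  refine Real.sqrt_le_iff.2 ⟨by positivity, ?_⟩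
  rw [mul_pow, Real.sq_sqrt (by positivity), Finset.mul_sum]
  exact Finset.sum_le_sum fun i _ => by rw [← mul_pow]; gcongr; exact h i

theorem norm_restrictRows_le_of_subset {S T : Set ι} (h : S ⊆ T)
    (x : ι → 𝕜) : ‖restrictRows S x‖ ≤ ‖restrictRows T x‖ := by
  have := euclidean_norm_le_mul (x := restrictRows S x) (y := restrictRows T x) zero_le_one
    fun i => by
      by_cases hi : i ∈ S
      · simp [restrictRows_apply_of_mem hi, restrictRows_apply_of_mem (h hi)]
      · simp [restrictRows_apply_of_notMem hi]
  simpa using this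

theorem FlWithin.round_entries (hε : 0 ≤ ε) {x x' x'' : EuclideanSpace 𝕜 ι}
    (h : FlWithin ε k M x x') (h' : ∀ i, Fl ε (x' i) (x'' i)) : FlWithin ε (k + 1) M x x'' :=
  h.round hε (euclidean_norm_le_mul hε h')

theorem FlDot.flWithin_inner (hε : 0 ≤ ε) {s : Finset ι} {u : EuclideanSpace 𝕜 ι} {v y : ι → 𝕜}
    {w : 𝕜} (hv : ∀ i ∉ s, v i = 0) (huv : FlWithin ε k M u (WithLp.toLp 2 v))
    (h : FlDot ε s (fun i => star (v i)) y w) :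
    FlWithin ε (k + s.card) (M * ‖WithLp.toLp 2 y‖) (inner 𝕜 u (WithLp.toLp 2 y)) w := by
  have hdot := h.flWithin hε (fun i _ => .refl hε 0 le_rfl) fun i _ => .refl hε 0 le_rfl
  have hinner : ∑ i ∈ s, star (v i) * y i = inner 𝕜 (WithLp.toLp 2 v) (WithLp.toLp 2 y) := by
    rw [PiLp.inner_apply, Finset.sum_subset s.subset_univ fun i _ hi => by simp [hv i hi]]
    exact Finset.sum_congr rfl fun i _ => mul_comm _ _
  simp only [zero_add, hinner, norm_star] at hdot
  refine (huv.inner_left _).trans hε hdot ?_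
  calc ∑ i ∈ s, ‖v i‖ * ‖y i‖ ≤ ∑ i, ‖v i‖ * ‖y i‖ :=
        Finset.sum_le_univ_sum_of_nonneg fun i => by positivity
    _ ≤ ‖WithLp.toLp 2 v‖ * ‖WithLp.toLp 2 y‖ := by
        rw [EuclideanSpace.norm_eq, EuclideanSpace.norm_eq]
        exact Real.sum_mul_le_sqrt_mul_sqrt _ _ _
    _ ≤ (1 + ε) ^ k * M * ‖WithLp.toLp 2 y‖ := by gcongr; exact huv.norm_le
    _ = (1 + ε) ^ k * (M * ‖WithLp.toLp 2 y‖) := by ring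

end Columns

section Householder

variable {𝕜 : Type*} [RCLike 𝕜]

theorem reflection_orthogonal_singleton_apply {E : Type*} [NormedAddCommGroup E]
    [InnerProductSpace 𝕜 E] (u y : E) :
    (𝕜 ∙ u)ᗮ.reflection y = y - (((2 / ‖u‖ ^ 2 : ℝ) : 𝕜) * ⟪u, y⟫_𝕜) • u := by
  rw [Submodule.reflection_orthogonal_apply, Submodule.reflection_singleton_apply, neg_sub,
    ← smul_assoc, two_smul]
  congr 2
  push_cast
  ring

/-- The unit scalar `z / |z|`, with the value `1` at `z = 0`. -/
noncomputable def phase (z : 𝕜) : 𝕜 :=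
  if z = 0 then 1 else z / (‖z‖ : 𝕜)

theorem norm_phase (z : 𝕜) : ‖phase z‖ = 1 := by
  by_cases hz : z = 0 <;> simp [phase, hz]

theorem phase_mul_norm (z : 𝕜) : phase z * (‖z‖ : 𝕜) = z := by
  by_cases hz : z = 0 <;> simp [phase, hz]

theorem star_phase_mul (z : 𝕜) : star (phase z) * z = (‖z‖ : 𝕜) := by
  by_cases hz : z = 0
  · simp [hz]
  · have : (‖z‖ : 𝕜) ≠ 0 := by simpa using hz
    simp [phase, hz, div_mul_eq_mul_div, RCLike.conj_mul, sq, this]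

variable {n : ℕ} {k : Fin n}

/-- The Householder vector of the rows `k, k + 1, …` of `x`: the reflection in the hyperplane
orthogonal to it maps these rows to a multiple of the `k`-th unit vector. Choosing the phase of
`x k` avoids cancellation. -/
noncomputable def householderVec (k : Fin n) (x : Fin n → 𝕜) : EuclideanSpace 𝕜 (Fin n) :=
  restrictRows (Set.Ici k) x +
    EuclideanSpace.single k (phase (x k) * (‖restrictRows (Set.Ici k) x‖ : 𝕜))

theorem householderVec_apply_self (x : Fin n → 𝕜) :
    householderVec k x k = phase (x k) * ((‖x k‖ + ‖restrictRows (Set.Ici k) x‖ : ℝ) : 𝕜) := by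
  simp [householderVec, restrictRows_apply_of_mem, mul_add, phase_mul_norm]

theorem householderVec_apply_of_lt {i : Fin n} (hi : i < k) (x : Fin n → 𝕜) :
    householderVec k x i = 0 := by
  simp [householderVec, restrictRows_apply_of_notMem, hi, hi.ne]

theorem householderVec_apply_of_gt {i : Fin n} (hi : k < i) (x : Fin n → 𝕜) :
    householderVec k x i = x i := by
  simp [householderVec, restrictRows_apply_of_mem, hi.le, hi.ne']

theorem householderVec_eq_zero {x : Fin n → 𝕜} (hx : restrictRows (Set.Ici k) x = 0) :
    householderVec k x = 0 := by
  simp [householderVec, hx]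

theorem inner_householderVec {S : Set (Fin n)} (hS : Set.Ici k ⊆ S) (x : Fin n → 𝕜) :
    ⟪householderVec k x, restrictRows S x⟫_𝕜 =
      ((‖restrictRows (Set.Ici k) x‖ * (‖restrictRows (Set.Ici k) x‖ + ‖x k‖) : ℝ) : 𝕜) := by
  have hrows : ⟪restrictRows (Set.Ici k) x, restrictRows S x⟫_𝕜 =
      ⟪restrictRows (Set.Ici k) x, restrictRows (Set.Ici k) x⟫_𝕜 := by
    simp only [PiLp.inner_apply]
    refine Finset.sum_congr rfl fun i _ => ?_
    by_cases hi : i ∈ Set.Ici k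
    · rw [restrictRows_apply_of_mem hi, restrictRows_apply_of_mem (hS hi)]
    · rw [restrictRows_apply_of_notMem hi, inner_zero_left, inner_zero_left]
  rw [householderVec, inner_add_left, hrows, inner_self_eq_norm_sq_to_K,
    EuclideanSpace.inner_single_left, restrictRows_apply_of_mem (hS Set.self_mem_Ici), map_mul,
    RCLike.conj_ofReal, mul_right_comm, ← RCLike.star_def, star_phase_mul]
  push_cast
  ring

theorem norm_householderVec_sq (x : Fin n → 𝕜) :
    ‖householderVec k x‖ ^ 2 =
      2 * (‖restrictRows (Set.Ici k) x‖ * (‖restrictRows (Set.Ici k) x‖ + ‖x k‖)) := by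
  have hself : star (phase (x k)) * phase (x k) = 1 := by
    simp [RCLike.star_def, RCLike.conj_mul, norm_phase]
  have hinner := inner_householderVec (k := k) subset_rfl x
  apply RCLike.ofReal_injective (K := 𝕜)
  rw [RCLike.ofReal_pow, ← inner_self_eq_norm_sq_to_K]
  nth_rw 2 [householderVec]
  rw [inner_add_right, hinner, EuclideanSpace.inner_single_right, householderVec_apply_self,
    map_mul, RCLike.conj_ofReal, ← RCLike.star_def]
  push_cast
  linear_combination (‖restrictRows (Set.Ici k) x‖ * (‖x k‖ + ‖restrictRows (Set.Ici k) x‖) : 𝕜) *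
    hself

theorem reflection_householderVec {S : Set (Fin n)} (hS : Set.Ici k ⊆ S) (x : Fin n → 𝕜) :
    (𝕜 ∙ householderVec k x)ᗮ.reflection (restrictRows S x) =
      restrictRows S x - householderVec k x := by
  rw [reflection_orthogonal_singleton_apply, inner_householderVec hS]
  rcases eq_or_ne (householderVec k x) 0 with hu | hu
  · simp [hu]
  have hne := norm_householderVec_sq (k := k) x ▸ pow_ne_zero 2 (norm_ne_zero_iff.2 hu)
  rw [norm_householderVec_sq, ← RCLike.ofReal_mul, div_mul_eq_mul_div, div_self hne,
    RCLike.ofReal_one, one_smul]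

theorem reflection_householderVec_of_rows_eq_zero {x : Fin n → 𝕜} {y : EuclideanSpace 𝕜 (Fin n)}
    (hy : ∀ i, k ≤ i → y i = 0) : (𝕜 ∙ householderVec k x)ᗮ.reflection y = y := by
  have hinner : ⟪householderVec k x, y⟫_𝕜 = 0 := by
    rw [PiLp.inner_apply]
    refine Finset.sum_eq_zero fun i _ => ?_
    rcases lt_or_ge i k with hi | hi
    · rw [householderVec_apply_of_lt hi, inner_zero_left]
    · rw [hy i hi, inner_zero_right]
  rw [reflection_orthogonal_singleton_apply, hinner, mul_zero, zero_smul, sub_zero]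

end Householder

section ComputedReflectors

variable {𝕜 : Type*} [RCLike 𝕜] {n : ℕ} {k : Fin n} {x v : Fin n → 𝕜} {ε ν β : ℝ} {σ : 𝕜}

theorem FlNorm.flWithin_restrictRows (hε : 0 ≤ ε) (hν : FlNorm ε (Finset.Ici k) x ν) :
    FlWithin ε (n + 1) ‖restrictRows (Set.Ici k) x‖ ‖restrictRows (Set.Ici k) x‖ ν := by
  rw [← Finset.coe_Ici, norm_restrictRows_coe]
  exact (hν.flWithin hε).mono hε (by simp)

theorem FlNorm.restrictRows_eq_zero (hε : 0 ≤ ε) (hn : (1 + ε) ^ (6 * n) ≤ 3 / 2)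
    (hν : FlNorm ε (Finset.Ici k) x 0) : restrictRows (Set.Ici k) x = 0 := by
  have h := (hν.flWithin_restrictRows hε).le_norm hε (norm_norm _).ge
    ((one_add_pow_mono hε (by have := k.pos; omega)).trans hn)
  simpa using h

theorem Fl.flWithin_phase (hε : 0 ≤ ε) (hε' : 1 + ε ≤ 3 / 2) {a : ℝ} {φ z : 𝕜} (ha : Fl ε ‖z‖ a)
    (hφ₀ : z = 0 → φ = 1) (hφ : z ≠ 0 → Fl ε (z / (a : 𝕜)) φ) : FlWithin ε 3 1 (phase z) φ := by
  by_cases hz : z = 0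
  · rw [hφ₀ hz, phase, if_pos hz]
    exact .refl hε 3 norm_one.le
  have hinv := (ha.flWithin.ofReal 𝕜).inv hε (RCLike.norm_ofReal _).ge (by simpa using hε')
  have hdiv := (FlWithin.refl hε 0 (le_refl ‖z‖)).mul hinv
  rw [norm_norm, mul_inv_cancel₀ (norm_ne_zero_iff.2 hz), ← div_eq_mul_inv,
    ← div_eq_mul_inv] at hdiv
  rw [phase, if_neg hz]
  exact hdiv.round hε (hφ hz)

namespace FlReflector

theorem flWithin_sigma (hε : 0 ≤ ε) (hn : (1 + ε) ^ (6 * n) ≤ 3 / 2)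
    (hν : FlNorm ε (Finset.Ici k) x ν) (h : FlReflector ε k x ν σ v β) :
    FlWithin ε (n + 5) ‖restrictRows (Set.Ici k) x‖
      (phase (x k) * (‖restrictRows (Set.Ici k) x‖ : 𝕜)) σ := by
  by_cases hν₀ : ν = 0
  · subst hν₀
    simpa [(h.1 rfl).1, hν.restrictRows_eq_zero hε hn] using
      FlWithin.refl hε _ (norm_zero (E := 𝕜)).le
  obtain ⟨-, -, -, a, φ, d, b, ha, hφ₀, hφ, hσ, -⟩ := h.2 hν₀
  have hε' : 1 + ε ≤ 3 / 2 := by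
    simpa using (one_add_pow_mono hε (show 1 ≤ 6 * n by have := k.pos; omega)).trans hn
  have hprod := (ha.flWithin_phase hε hε' hφ₀ hφ).mul ((hν.flWithin_restrictRows hε).ofReal 𝕜)
  rw [one_mul] at hprod
  exact (hprod.round hε hσ).mono hε (by omega)

theorem flWithin_vec (hε : 0 ≤ ε) (hn : (1 + ε) ^ (6 * n) ≤ 3 / 2)
    (hν : FlNorm ε (Finset.Ici k) x ν) (h : FlReflector ε k x ν σ v β) :
    FlWithin ε (n + 6) ‖householderVec k x‖ (householderVec k x) (WithLp.toLp 2 v) := by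
  by_cases hν₀ : ν = 0
  · subst hν₀
    rw [householderVec_eq_zero (hν.restrictRows_eq_zero hε hn), (h.1 rfl).2.1]
    exact .refl hε _ le_rfl
  obtain ⟨hlt, hgt, hk, -⟩ := h.2 hν₀
  have hentry : FlWithin ε (n + 6) (‖x k‖ + ‖restrictRows (Set.Ici k) x‖)
      (x k + phase (x k) * (‖restrictRows (Set.Ici k) x‖ : 𝕜)) (v k) :=
    ((FlWithin.refl hε (n + 5) (le_refl ‖x k‖)).add (h.flWithin_sigma hε hn hν)).round hε hk
  have herror : WithLp.toLp 2 v - householderVec k x =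
      EuclideanSpace.single k (v k - householderVec k x k) := by
    ext i
    rcases lt_trichotomy i k with hi | rfl | hi
    · simp [hlt i hi, householderVec_apply_of_lt hi, hi.ne]
    · simp
    · simp [hgt i hi, householderVec_apply_of_gt hi, hi.ne']
  have hself : x k + phase (x k) * (‖restrictRows (Set.Ici k) x‖ : 𝕜) = householderVec k x k := by
    rw [householderVec_apply_self, RCLike.ofReal_add, mul_add, phase_mul_norm]
  have hnorm : ‖x k‖ + ‖restrictRows (Set.Ici k) x‖ ≤ ‖householderVec k x‖ := by
    refine le_trans (le_of_eq ?_) (PiLp.norm_apply_le (householderVec k x) k)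
    rw [householderVec_apply_self, norm_mul, norm_phase, one_mul, RCLike.norm_ofReal,
      abs_of_nonneg (by positivity)]
  refine ⟨le_rfl, ?_⟩
  rw [herror, PiLp.norm_single, ← hself]
  exact (hentry.mono_scale hε hnorm).2

theorem flWithin_beta (hε : 0 ≤ ε) (hn : (1 + ε) ^ (6 * n) ≤ 3 / 2)
    (hν : FlNorm ε (Finset.Ici k) x ν) (h : FlReflector ε k x ν σ v β) :
    FlWithin ε (4 * n + 9) (2 / ‖householderVec k x‖ ^ 2) (2 / ‖householderVec k x‖ ^ 2) β := by
  by_cases hν₀ : ν = 0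
  · subst hν₀
    simpa [(h.1 rfl).2.2, householderVec_eq_zero (hν.restrictRows_eq_zero hε hn)] using
      FlWithin.refl hε _ (norm_zero (E := ℝ)).le
  obtain ⟨-, -, -, a, φ, d, b, ha, -, -, -, hd, hb, hβ⟩ := h.2 hν₀
  have hρ := hν.flWithin_restrictRows hε
  have ha' : FlWithin ε (n + 1) ‖x k‖ ‖x k‖ a := by
    simpa using ha.flWithin.mono hε (Nat.le_add_left 1 n)
  have hprod := (hρ.mul ((hρ.add ha').round hε hd)).round hε hb
  have hinv := hprod.inv hε (Real.norm_of_nonneg (by positivity)).ge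
    ((one_add_pow_mono hε (by have := k.pos; omega)).trans hn)
  have hγ : 2 / ‖householderVec k x‖ ^ 2 =
    (‖restrictRows (Set.Ici k) x‖ * (‖restrictRows (Set.Ici k) x‖ + ‖x k‖))⁻¹ := by
    rw [norm_householderVec_sq, div_mul_cancel_left₀ two_ne_zero]
  rw [hγ]
  exact (hinv.round hε (by rwa [← one_div])).mono hε (by omega)

end FlReflector

end ComputedReflectors

section AppliedReflectors

variable {𝕜 : Type*} [RCLike 𝕜] {n : ℕ} {k : Fin n} {v y y' : Fin n → 𝕜} {ε β : ℝ}

/-- The computed data `v`, `β` of a reflector acting on the rows `k, k + 1, …` agree up to `O(n)`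
roundings with the data of the exact reflection in the hyperplane orthogonal to `u`. If `u = 0`,
then `2 / ‖u‖ ^ 2 = 0` and the reflection is the identity. -/
structure IsComputedReflector (ε : ℝ) (k : Fin n) (u : EuclideanSpace 𝕜 (Fin n)) (v : Fin n → 𝕜)
    (β : ℝ) : Prop where
  vec : FlWithin ε (n + 6) ‖u‖ u (WithLp.toLp 2 v)
  vec_eq_zero : ∀ i < k, v i = 0
  coeff : FlWithin ε (4 * n + 9) (2 / ‖u‖ ^ 2) (2 / ‖u‖ ^ 2) β

theorem FlReflector.isComputedReflector {x : Fin n → 𝕜} {ν : ℝ} {σ : 𝕜} (hε : 0 ≤ ε)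
    (hn : (1 + ε) ^ (6 * n) ≤ 3 / 2) (hν : FlNorm ε (Finset.Ici k) x ν)
    (h : FlReflector ε k x ν σ v β) : IsComputedReflector ε k (householderVec k x) v β where
  vec := h.flWithin_vec hε hn hν
  vec_eq_zero i hi := by
    by_cases hν₀ : ν = 0
    · rw [(h.1 hν₀).2.1, Pi.zero_apply]
    · exact (h.2 hν₀).1 i hi
  coeff := h.flWithin_beta hε hn hν

namespace FlReflect

theorem indicator {S : Set (Fin n)} (hS : Set.Ici k ⊆ S) (h : FlReflect ε k v β y y') :
    FlReflect ε k v β (S.indicator y) (S.indicator y') := by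
  obtain ⟨hlt, w, g, ⟨q, hq, hw⟩, hg, hge⟩ := h
  refine ⟨fun i hi => ?_, w, g, ⟨q, fun i hi => ?_, hw⟩, hg, fun i hi => ?_⟩
  · by_cases his : i ∈ S <;> simp [his, hlt i hi]
  · rw [Set.indicator_of_mem (hS (Finset.mem_Ici.1 hi))]
    exact hq i hi
  · rw [Set.indicator_of_mem (hS hi), Set.indicator_of_mem (hS hi)]
    exact hge i hi

theorem flWithin_reflection (hε : 0 ≤ ε) {u : EuclideanSpace 𝕜 (Fin n)}
    (hu : IsComputedReflector ε k u v β) (h : FlReflect ε k v β y y') :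
    FlWithin ε (21 * n + 72) ‖WithLp.toLp 2 y‖
      ((𝕜 ∙ u)ᗮ.reflection (WithLp.toLp 2 y)) (WithLp.toLp 2 y') := by
  obtain ⟨hlt, w, g, hw, hg, hge⟩ := h
  choose p hp hy' using hge
  set Y : EuclideanSpace 𝕜 (Fin n) := WithLp.toLp 2 y
  have hinner : FlWithin ε (n + 6 + n) (‖u‖ * ‖Y‖) ⟪u, Y⟫_𝕜 w :=
    (hw.flWithin_inner hε (fun i hi => hu.vec_eq_zero i (by simpa using hi)) hu.vec).mono hε
      (by simp)
  have hcoeff := ((hu.coeff.ofReal 𝕜).mul hinner).round hε hg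
  have hscaled := hcoeff.smul hu.vec
  have hupdate : FlWithin ε _ _ _ (WithLp.toLp 2 fun i => if hi : k ≤ i then p i hi else 0) :=
    hscaled.round_entries hε fun i => by
      by_cases hi : k ≤ i
      · simpa [hi, mul_comm] using hp i hi
      · simp [hi, hu.vec_eq_zero i (not_le.1 hi), Fl]
  have hscale : 2 / ‖u‖ ^ 2 * (‖u‖ * ‖Y‖) * ‖u‖ ≤ 2 * ‖Y‖ := by
    rcases eq_or_ne u 0 with rfl | hu₀
    · simp
    · have := norm_ne_zero_iff.2 hu₀
      exact le_of_eq (by field_simp)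
  have hresult := ((FlWithin.refl hε _ le_rfl).sub
    (hupdate.mono_scale hε hscale)).round_entries (x'' := WithLp.toLp 2 y') hε fun i => by
      by_cases hi : k ≤ i
      · simpa [hi] using hy' i hi
      · simp [hi, Fl, hlt i (not_le.1 hi), mul_nonneg hε]
  -- `7 * n + 24` roundings at the scale `3 * ‖Y‖`.
  rw [← reflection_orthogonal_singleton_apply,
    show ‖Y‖ + 2 * ‖Y‖ = (3 : ℕ) * ‖Y‖ by push_cast; ring] at hresult
  exact (hresult.scale hε (LinearIsometryEquiv.norm_map _ _).le).mono hε (by omega)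

end FlReflect

end AppliedReflectors

section Accumulation

variable {𝕜 V : Type*} [NormedField 𝕜] [SeminormedAddCommGroup V] [NormedSpace 𝕜 V] {n m : ℕ}
  {ε : ℝ}

theorem FlWithin.prod_ofFn_apply (hε : 0 ≤ ε) (H : Fin n → V ≃ₗᵢ[𝕜] V) (z : ℕ → V)
    (h : ∀ k : Fin n, FlWithin ε m ‖z k‖ (z k) (H k (z (k + 1)))) :
    FlWithin ε (n * m) ‖z 0‖ (z 0) ((List.ofFn H).prod (z n)) := by
  induction n generalizing z with
  | zero => simpa using refl hε 0 (le_refl ‖z 0‖)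
  | succ n ih =>
    have hfirst : FlWithin ε m ‖z 0‖ (z 0) (H 0 (z 1)) := h 0
    have hrest := (ih (fun k => H k.succ) (fun k => z (k + 1)) fun k => h k.succ).map (H 0)
    rw [List.ofFn_succ, List.prod_cons, LinearIsometryEquiv.coe_mul, Function.comp_apply,
      Nat.succ_mul, add_comm]
    refine hfirst.trans hε hrest ?_
    simpa using hfirst.norm_le

theorem FlWithin.apply_prod_ofFn (hε : 0 ≤ ε) (H : Fin n → V ≃ₗᵢ[𝕜] V) (z : ℕ → V)
    (h : ∀ k : Fin n, FlWithin ε m ‖z (k + 1)‖ (H k (z (k + 1))) (z k)) :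
    FlWithin ε (n * m) ‖z n‖ ((List.ofFn H).prod (z n)) (z 0) := by
  induction n generalizing z with
  | zero => simpa using refl hε 0 (le_refl ‖z 0‖)
  | succ n ih =>
    have hfirst : FlWithin ε m ‖z 1‖ (H 0 (z 1)) (z 0) := h 0
    have hrest := ih (fun k => H k.succ) (fun k => z (k + 1)) fun k => h k.succ
    rw [List.ofFn_succ, List.prod_cons, LinearIsometryEquiv.coe_mul, Function.comp_apply,
      Nat.succ_mul]
    exact (hrest.map (H 0)).trans hε hfirst hrest.norm_le

end Accumulation

section PivotedQR

variable {𝕜 : Type*} [RCLike 𝕜] {n : ℕ} {k : Fin n} {ε : ℝ}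

/-- One step of the factorization with column pivoting, from the working array `W` to `W'`: the
conjuncts in `IsPivotedQR`. -/
structure IsPivotedStep (ε : ℝ) (k : Fin n) (W W' : Matrix (Fin n) (Fin n) 𝕜) (ν : Fin n → ℝ)
    (σ : 𝕜) (v : Fin n → 𝕜) (β : ℝ) : Prop where
  norm : ∀ j, k ≤ j → FlNorm ε (Finset.Ici k) (W.col j) (ν j)
  pivot : ∀ j, k ≤ j → ν j ≤ ν k
  reflector : FlReflector ε k (W.col k) (ν k) σ v β
  finished : ∀ j < k, W'.col j = W.col j
  pivotColumn : ∀ i, W' i k = if i < k then W i k else if i = k then -σ else 0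
  update : ∀ j, k < j → FlReflect ε k v β (W.col j) (W'.col j)

/-- `W 0, …, W n` are the working arrays of a factorization with column pivoting. -/
def IsPivotedRun (ε : ℝ) (W : ℕ → Matrix (Fin n) (Fin n) 𝕜) (ν : Fin n → Fin n → ℝ)
    (σ : Fin n → 𝕜) (v : Fin n → Fin n → 𝕜) (β : Fin n → ℝ) : Prop :=
  ∀ k : Fin n, IsPivotedStep ε k (W k) (W (k + 1)) (ν k) (σ k) (v k) (β k)

theorem IsPivotedQR.exists_run {E : Matrix (Fin n) (Fin n) 𝕜} {π : Equiv.Perm (Fin n)}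
    {v : Fin n → Fin n → 𝕜} {β : Fin n → ℝ} {R : Matrix (Fin n) (Fin n) 𝕜}
    (h : IsPivotedQR ε E π v β R) :
    ∃ W ν σ, W 0 = E.submatrix id π ∧ W n = R ∧ IsPivotedRun ε W ν σ v β := by
  obtain ⟨W, ν, σ, h₀, hn, hstep⟩ := h
  refine ⟨W, ν, σ, h₀, hn, fun k => ?_⟩
  obtain ⟨hnorm, hpivot, hreflector, hfinished, hcolumn, hupdate⟩ := hstep k
  exact ⟨hnorm, hpivot, hreflector, fun j hj => funext (hfinished j hj), hcolumn, hupdate⟩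

namespace IsPivotedStep

variable {W W' : Matrix (Fin n) (Fin n) 𝕜} {ν : Fin n → ℝ} {σ : 𝕜} {v : Fin n → 𝕜} {β : ℝ}

theorem flWithin_pivotColumn (hε : 0 ≤ ε) (hn : (1 + ε) ^ (6 * n) ≤ 3 / 2)
    (h : IsPivotedStep ε k W W' ν σ v β) {S : Set (Fin n)} (hS : Set.Ici k ⊆ S) :
    FlWithin ε (n + 5) ‖restrictRows S (W.col k)‖
      ((𝕜 ∙ householderVec k (W.col k))ᗮ.reflection (restrictRows S (W.col k)))
      (restrictRows S (W'.col k)) := by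
  refine ⟨(LinearIsometryEquiv.norm_map _ _).le, ?_⟩
  have herror : restrictRows S (W'.col k) -
      (𝕜 ∙ householderVec k (W.col k))ᗮ.reflection (restrictRows S (W.col k)) =
      -EuclideanSpace.single k
        (σ - phase (W k k) * (‖restrictRows (Set.Ici k) (W.col k)‖ : 𝕜)) := by
    rw [reflection_householderVec hS]
    ext i
    rcases lt_trichotomy i k with hi | rfl | hi
    · by_cases hiS : i ∈ S <;>
        simp [restrictRows, hiS, householderVec_apply_of_lt hi, h.pivotColumn, hi, hi.ne]
    · have hiS : i ∈ S := hS Set.self_mem_Ici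
      simp only [householderVec, PiLp.sub_apply, PiLp.neg_apply, PiLp.add_apply,
        PiLp.single_apply, if_true, restrictRows_apply_of_mem hiS,
        restrictRows_apply_of_mem Set.self_mem_Ici, Matrix.col_apply, h.pivotColumn, lt_irrefl,
        if_false]
      ring
    · have hiS : i ∈ S := hS hi.le
      simp [restrictRows_apply_of_mem hiS, householderVec_apply_of_gt hi, h.pivotColumn, hi.not_gt,
        hi.ne']
  rw [herror, norm_neg, PiLp.norm_single]
  exact ((h.reflector.flWithin_sigma hε hn (h.norm k le_rfl)).mono_scale hε
    (norm_restrictRows_le_of_subset hS _)).2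

theorem flWithin_reflection (hε : 0 ≤ ε) (hn : (1 + ε) ^ (6 * n) ≤ 3 / 2)
    (h : IsPivotedStep ε k W W' ν σ v β) {S : Set (Fin n)} (hS : Set.Ici k ⊆ S) (j : Fin n)
    (hW : ∀ i, j < i → j < k → W i j = 0) :
    FlWithin ε (21 * n + 72) ‖restrictRows S (W.col j)‖
      ((𝕜 ∙ householderVec k (W.col k))ᗮ.reflection (restrictRows S (W.col j)))
      (restrictRows S (W'.col j)) := by
  rcases lt_trichotomy j k with hj | rfl | hj
  · rw [h.finished j hj, reflection_householderVec_of_rows_eq_zero fun i hi => ?_]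
    · exact .refl hε _ le_rfl
    · rw [restrictRows_apply_of_mem (hS hi)]
      exact hW i (hj.trans_le hi) hj
  · exact (h.flWithin_pivotColumn hε hn hS).mono hε (by omega)
  · exact ((h.update j hj).indicator hS).flWithin_reflection hε
      (h.reflector.isComputedReflector hε hn (h.norm k le_rfl))

end IsPivotedStep

namespace IsPivotedRun

variable {W : ℕ → Matrix (Fin n) (Fin n) 𝕜} {ν : Fin n → Fin n → ℝ} {σ : Fin n → 𝕜}
  {v : Fin n → Fin n → 𝕜} {β : Fin n → ℝ}

theorem col_eq (h : IsPivotedRun ε W ν σ v β) {j : Fin n} {k : ℕ} (hkn : k ≤ n) (hjk : j < k) :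
    (W k).col j = (W (j + 1)).col j := by
  induction k, hjk using Nat.le_induction with
  | base => rfl
  | succ k hjk ih => exact ((h ⟨k, hkn⟩).finished j hjk).trans (ih (Nat.le_of_succ_le hkn))

theorem apply_eq_zero (h : IsPivotedRun ε W ν σ v β) {i j : Fin n} {k : ℕ} (hkn : k ≤ n)
    (hjk : j < k) (hij : j < i) : W k i j = 0 := by
  refine (congrFun (h.col_eq hkn hjk) i).trans (((h j).pivotColumn i).trans ?_)
  rw [if_neg hij.not_gt, if_neg hij.ne']

theorem diag_eq (h : IsPivotedRun ε W ν σ v β) (i : Fin n) : W n i i = -σ i := by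
  refine (congrFun (h.col_eq le_rfl i.is_lt) i).trans (((h i).pivotColumn i).trans ?_)
  rw [if_neg (lt_irrefl i), if_pos rfl]

theorem flWithin_reflection (hε : 0 ≤ ε) (hn : (1 + ε) ^ (6 * n) ≤ 3 / 2)
    (h : IsPivotedRun ε W ν σ v β) (k j : Fin n) {S : Set (Fin n)} (hS : Set.Ici k ⊆ S) :
    FlWithin ε (21 * n + 72) ‖restrictRows S ((W k).col j)‖
      ((𝕜 ∙ householderVec k ((W k).col k))ᗮ.reflection (restrictRows S ((W k).col j)))
      (restrictRows S ((W (k + 1)).col j)) :=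
  (h k).flWithin_reflection hε hn hS j fun _ hij hjk => h.apply_eq_zero k.is_lt.le hjk hij

theorem norm_restrictRows_le (hε : 0 ≤ ε) (hn : (1 + ε) ^ (6 * n) ≤ 3 / 2)
    (h : IsPivotedRun ε W ν σ v β) (i j : Fin n) {k : ℕ} (hkn : k ≤ n) (hik : i ≤ k) :
    ‖restrictRows (Set.Ici i) ((W k).col j)‖ ≤
      (1 + ε) ^ ((k - i) * (21 * n + 72)) * ‖restrictRows (Set.Ici i) ((W i).col j)‖ := by
  induction k, hik using Nat.le_induction with
  | base => simp
  | succ k hik ih =>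
    have hstep := (h.flWithin_reflection hε hn ⟨k, hkn⟩ j (Set.Ici_subset_Ici.2 hik)).norm_le
    rw [Nat.succ_sub hik, Nat.succ_mul, add_comm (_ * _), pow_add, mul_assoc]
    exact hstep.trans (mul_le_mul_of_nonneg_left (ih (Nat.le_of_succ_le hkn)) (by positivity))

/-- The factor collects the growth during the elimination, the error of the comparison of the
computed column norms, and the error of the new diagonal entry. -/
theorem norm_restrictRows_le_norm_diag (hε : 0 ≤ ε) (hn : (1 + ε) ^ (6 * n) ≤ 3 / 2)
    (h : IsPivotedRun ε W ν σ v β) {i j : Fin n} (hij : i ≤ j) :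
    ‖restrictRows (Set.Ici i) ((W n).col j)‖ ≤
      (1 + ε) ^ (n * (21 * n + 72) + (5 * n + 13)) * ‖W n i i‖ := by
  have hε₁ : ε ≤ 1 := by
    linarith [(one_add_pow_mono hε (show 1 ≤ 6 * n by have := i.pos; omega)).trans hn]
  have hnj := ((h i).norm j hij).flWithin_restrictRows hε
  have hni := ((h i).norm i le_rfl).flWithin_restrictRows hε
  have hσ := (h i).reflector.flWithin_sigma hε hn ((h i).norm i le_rfl)
  calc ‖restrictRows (Set.Ici i) ((W n).col j)‖
      ≤ (1 + ε) ^ ((n - i) * (21 * n + 72)) * ‖restrictRows (Set.Ici i) ((W i).col j)‖ :=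
        h.norm_restrictRows_le hε hn i j le_rfl i.is_lt.le
    _ ≤ (1 + ε) ^ (n * (21 * n + 72)) * ((1 + ε) ^ (2 * (n + 1)) * ‖ν i j‖) := by
        gcongr ?_ * ?_
        · exact one_add_pow_mono hε (by gcongr; omega)
        · exact hnj.le_norm hε (norm_norm _).ge
            ((one_add_pow_mono hε (by have := i.pos; omega)).trans hn)
    _ ≤ (1 + ε) ^ (n * (21 * n + 72)) * ((1 + ε) ^ (2 * (n + 1)) * ‖ν i i‖) := by
        gcongr _ * (_ * ?_)
        rw [Real.norm_of_nonneg (((h i).norm j hij).nonneg hε₁),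
          Real.norm_of_nonneg (((h i).norm i le_rfl).nonneg hε₁)]
        exact (h i).pivot j hij
    _ ≤ (1 + ε) ^ (n * (21 * n + 72)) * ((1 + ε) ^ (2 * (n + 1)) * ((1 + ε) ^ (n + 1) *
          ((1 + ε) ^ (2 * (n + 5)) * ‖σ i‖))) := by
        gcongr _ * (_ * ?_)
        refine hni.norm_le.trans ?_
        gcongr
        refine hσ.le_norm hε ?_ ((one_add_pow_mono hε (by have := i.pos; omega)).trans hn)
        rw [norm_mul, norm_phase, one_mul, RCLike.norm_ofReal, abs_norm]
    _ = (1 + ε) ^ (n * (21 * n + 72) + (5 * n + 13)) * ‖W n i i‖ := by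
        rw [h.diag_eq, norm_neg]; ring

end IsPivotedRun

end PivotedQR

section BackwardErrors

variable {𝕜 : Type*} [RCLike 𝕜] {n : ℕ} {ε : ℝ}

theorem IsPivotedQR.apply_eq_zero {E : Matrix (Fin n) (Fin n) 𝕜} {π : Equiv.Perm (Fin n)}
    {v : Fin n → Fin n → 𝕜} {β : Fin n → ℝ} {R : Matrix (Fin n) (Fin n) 𝕜}
    (h : IsPivotedQR ε E π v β R) {i j : Fin n} (hij : j < i) : R i j = 0 := by
  obtain ⟨W, ν, σ, -, rfl, hrun⟩ := h.exists_run
  exact hrun.apply_eq_zero le_rfl j.is_lt hij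

theorem IsPivotedQR.norm_restrictRows_le (hε : 0 ≤ ε) (hn : (1 + ε) ^ (6 * n) ≤ 3 / 2)
    {E : Matrix (Fin n) (Fin n) 𝕜} {π : Equiv.Perm (Fin n)} {v : Fin n → Fin n → 𝕜}
    {β : Fin n → ℝ} {R : Matrix (Fin n) (Fin n) 𝕜} (h : IsPivotedQR ε E π v β R) {i j : Fin n}
    (hij : i ≤ j) :
    ‖restrictRows (Set.Ici i) (R.col j)‖ ≤ (1 + ε) ^ (111 * n ^ 2) * ‖R i i‖ := by
  obtain ⟨W, ν, σ, -, rfl, hrun⟩ := h.exists_run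
  refine (hrun.norm_restrictRows_le_norm_diag hε hn hij).trans ?_
  gcongr ?_ * _
  refine one_add_pow_mono hε ?_
  nlinarith [i.pos]

/-- The exact unitary factor that belongs to the exact Householder vectors `u 0, …, u (n - 1)`. -/
noncomputable def reflectionProduct (u : Fin n → EuclideanSpace 𝕜 (Fin n)) :
    EuclideanSpace 𝕜 (Fin n) ≃ₗᵢ[𝕜] EuclideanSpace 𝕜 (Fin n) :=
  (List.ofFn fun k => (𝕜 ∙ u k)ᗮ.reflection).prod

theorem mul_reflection_bound_le (n : ℕ) : n * (21 * n + 72) ≤ 93 * n ^ 2 := by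
  nlinarith [n.le_mul_self]

section

variable {u : Fin n → EuclideanSpace 𝕜 (Fin n)} {v : Fin n → Fin n → 𝕜} {β : Fin n → ℝ}

theorem IsFormedQ.flWithin_reflectionProduct (hε : 0 ≤ ε)
    (hu : ∀ k, IsComputedReflector ε k (u k) (v k) (β k)) {Q : Matrix (Fin n) (Fin n) 𝕜}
    (h : IsFormedQ ε v β Q) (j : Fin n) :
    FlWithin ε (93 * n ^ 2) 1 (reflectionProduct u (EuclideanSpace.single j 1))
      (WithLp.toLp 2 (Q.col j)) := by
  obtain ⟨G, hGn, rfl, hG⟩ := h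
  have hone : WithLp.toLp 2 ((G n).col j) = EuclideanSpace.single j (1 : 𝕜) := by
    ext i
    simp [hGn, Matrix.one_apply]
  have := FlWithin.apply_prod_ofFn hε (fun k => (𝕜 ∙ u k)ᗮ.reflection)
    (fun k => WithLp.toLp 2 ((G k).col j)) fun k => (hG k j).flWithin_reflection hε (hu k)
  rw [hone, PiLp.norm_single, norm_one] at this
  exact this.mono hε (mul_reflection_bound_le n)

theorem IsReflectorProduct.flWithin_reflectionProduct (hε : 0 ≤ ε)
    (hu : ∀ k, IsComputedReflector ε k (u k) (v k) (β k)) {D X : Matrix (Fin n) (Fin n) 𝕜}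
    (h : IsReflectorProduct ε v β D X) (j : Fin n) :
    FlWithin ε (93 * n ^ 2) ‖WithLp.toLp 2 (D.col j)‖ (WithLp.toLp 2 (D.col j))
      (reflectionProduct u (WithLp.toLp 2 (X.col j))) := by
  obtain ⟨Z, rfl, rfl, hZ⟩ := h
  refine (FlWithin.prod_ofFn_apply hε (fun k => (𝕜 ∙ u k)ᗮ.reflection)
    (fun k => WithLp.toLp 2 ((Z k).col j)) fun k => ?_).mono hε (mul_reflection_bound_le n)
  have hstep := FlReflect.flWithin_reflection (y := (Z k).col j) (y' := (Z (k + 1)).col j) hε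
    (hu k) (hZ k j)
  simpa only [Submodule.reflection_reflection] using hstep.map (𝕜 ∙ u k)ᗮ.reflection

theorem IsPivotedQR.exists_isComputedReflector (hε : 0 ≤ ε) (hn : (1 + ε) ^ (6 * n) ≤ 3 / 2)
    {E R : Matrix (Fin n) (Fin n) 𝕜} {π : Equiv.Perm (Fin n)} (h : IsPivotedQR ε E π v β R) :
    ∃ u : Fin n → EuclideanSpace 𝕜 (Fin n),
      (∀ k, IsComputedReflector ε k (u k) (v k) (β k)) ∧
      ∀ j, FlWithin ε (93 * n ^ 2) ‖WithLp.toLp 2 (E.col (π j))‖ (WithLp.toLp 2 (E.col (π j)))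
        (reflectionProduct u (WithLp.toLp 2 (R.col j))) := by
  obtain ⟨W, ν, σ, hW₀, rfl, hrun⟩ := h.exists_run
  refine ⟨fun k => householderVec k ((W k).col k), fun k =>
    (hrun k).reflector.isComputedReflector hε hn ((hrun k).norm k le_rfl), fun j => ?_⟩
  have hE : WithLp.toLp 2 (E.col (π j)) = WithLp.toLp 2 ((W 0).col j) := by rw [hW₀]; rfl
  rw [hE]
  refine (FlWithin.prod_ofFn_apply hε (fun k => (𝕜 ∙ householderVec k ((W k).col k))ᗮ.reflection)
    (fun k => WithLp.toLp 2 ((W k).col j)) fun k => ?_).mono hε (mul_reflection_bound_le n)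
  have hstep := hrun.flWithin_reflection hε hn k j (Set.subset_univ _)
  simpa only [restrictRows_univ, Submodule.reflection_reflection] using
    hstep.map (𝕜 ∙ householderVec k ((W k).col k))ᗮ.reflection

end

theorem FlWithin.of_entries {ι : Type*} [Fintype ι] {k : ℕ} {M : ℝ} (hε : 0 ≤ ε)
    {x x' : EuclideanSpace 𝕜 ι} (hx : ‖x‖ ≤ M) (h : ∀ i, FlWithin ε k M (x i) (x' i)) :
    FlWithin ε (Fintype.card ι * k) M x x' := by
  classical
  have hsingle (i : ι) :
      FlWithin ε k M (EuclideanSpace.single i (x i)) (EuclideanSpace.single i (x' i)) := by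
    simpa only [FlWithin, ← PiLp.single_sub, PiLp.norm_single] using h i
  have hsum (y : EuclideanSpace 𝕜 ι) : ∑ i, EuclideanSpace.single i (y i) = y := by
    ext j
    simp [Pi.single_apply]
  refine scale hε ?_ hx
  simpa [hsum] using FlWithin.sum (s := Finset.univ) fun i _ => hsingle i

theorem IsMatMulProduct.flWithin (hε : 0 ≤ ε) {k : ℕ} {Q D X : Matrix (Fin n) (Fin n) 𝕜}
    {f : EuclideanSpace 𝕜 (Fin n) ≃ₗᵢ[𝕜] EuclideanSpace 𝕜 (Fin n)}
    (hQ : ∀ j, FlWithin ε k 1 (f (EuclideanSpace.single j 1)) (WithLp.toLp 2 (Q.col j)))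
    (h : IsMatMulProduct ε Q D X) (j : Fin n) :
    FlWithin ε (n * (k + n)) ‖WithLp.toLp 2 (D.col j)‖ (WithLp.toLp 2 (D.col j))
      (f (WithLp.toLp 2 (X.col j))) := by
  have hentries : FlWithin ε (n * (k + n)) ‖WithLp.toLp 2 (D.col j)‖
      (f.symm (WithLp.toLp 2 (D.col j))) (WithLp.toLp 2 (X.col j)) := by
    have := FlWithin.of_entries (k := k + n) (x := f.symm (WithLp.toLp 2 (D.col j)))
      (x' := WithLp.toLp 2 (X.col j)) hε (f.symm.norm_map _).le fun i => by
        have hdot := FlDot.flWithin_inner (y := D.col j) hε (by simp) (hQ i) (h i j)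
        simpa [LinearIsometryEquiv.inner_map_eq_flip, EuclideanSpace.inner_single_left] using hdot
    simpa using this
  simpa using hentries.map f

theorem exists_mem_unitaryGroup_toLp_mulVec {ι : Type*} [Fintype ι] [DecidableEq ι]
    (f : EuclideanSpace 𝕜 ι ≃ₗᵢ[𝕜] EuclideanSpace 𝕜 ι) :
    ∃ U ∈ Matrix.unitaryGroup ι 𝕜, ∀ x, WithLp.toLp 2 (U.mulVec x) = f (WithLp.toLp 2 x) := by
  refine ⟨(Matrix.toEuclideanCLM (n := ι) (𝕜 := 𝕜)).symm (Unitary.linearIsometryEquiv.symm f),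
    Unitary.map_mem _ (SetLike.coe_mem _), fun x => ?_⟩
  rw [← Matrix.toEuclideanCLM_toLp, StarAlgEquiv.apply_symm_apply,
    Unitary.coe_symm_linearIsometryEquiv_apply]
  rfl

end BackwardErrors

section ColumnNorms

variable {𝕜 : Type*} [RCLike 𝕜] {n : ℕ} {ε : ℝ}

theorem colNorm_eq_norm (M : Matrix (Fin n) (Fin n) 𝕜) (j : Fin n) :
    colNorm M j = ‖WithLp.toLp 2 (M.col j)‖ :=
  (EuclideanSpace.norm_eq (WithLp.toLp 2 (M.col j))).symm

theorem colNorm_nonneg (M : Matrix (Fin n) (Fin n) 𝕜) (j : Fin n) : 0 ≤ colNorm M j :=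
  Real.sqrt_nonneg _

theorem colNorm_unitary_mul {U : Matrix (Fin n) (Fin n) 𝕜}
    (hU : U ∈ Matrix.unitaryGroup (Fin n) 𝕜) (M : Matrix (Fin n) (Fin n) 𝕜) (j : Fin n) :
    colNorm (U * M) j = colNorm M j := by
  have hcol : WithLp.toLp 2 ((U * M).col j) =
      Matrix.toEuclideanCLM (n := Fin n) (𝕜 := 𝕜) U (WithLp.toLp 2 (M.col j)) := rfl
  rw [colNorm_eq_norm, colNorm_eq_norm, hcol,
    ContinuousLinearMap.norm_map_of_mem_unitary (Unitary.map_mem _ hU)]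

theorem colNorm_unitary_mul_submatrix {U : Matrix (Fin n) (Fin n) 𝕜}
    (hU : U ∈ Matrix.unitaryGroup (Fin n) 𝕜) (M : Matrix (Fin n) (Fin n) 𝕜)
    (π : Equiv.Perm (Fin n)) (j : Fin n) :
    colNorm (U * M.submatrix id π.symm) (π j) = colNorm M j := by
  rw [colNorm_unitary_mul hU]
  simp [colNorm]

theorem frobNorm_le_card_mul {M : Matrix (Fin n) (Fin n) 𝕜} {h : ℝ} (hh : 0 ≤ h)
    (hM : ∀ j, colNorm M j ≤ h) : frobNorm M ≤ n * h := by
  refine Real.sqrt_le_iff.2 ⟨by positivity, ?_⟩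
  calc ∑ i, ∑ j, ‖M i j‖ ^ 2 = ∑ j, colNorm M j ^ 2 := by
        rw [Finset.sum_comm]
        exact Finset.sum_congr rfl fun j _ => (Real.sq_sqrt (by positivity)).symm
    _ ≤ ∑ _j : Fin n, h ^ 2 := Finset.sum_le_sum fun j _ =>
        pow_le_pow_left₀ (colNorm_nonneg M j) (hM j) 2
    _ = n * h ^ 2 := by simp
    _ ≤ (n * h) ^ 2 := by
        rw [mul_pow]
        gcongr
        exact_mod_cast Nat.le_self_pow two_ne_zero n

theorem FlWithin.colNorm_sub_le {k : ℕ} {M M' : Matrix (Fin n) (Fin n) 𝕜} {j : Fin n}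
    (h : FlWithin ε k ‖WithLp.toLp 2 (M.col j)‖ (WithLp.toLp 2 (M.col j))
      (WithLp.toLp 2 (M'.col j))) :
    colNorm (M' - M) j ≤ ((1 + ε) ^ k - 1) * colNorm M j := by
  rw [colNorm_eq_norm, colNorm_eq_norm]
  exact h.2

theorem IsPivotedQR.exists_unitary (hε : 0 ≤ ε) (hn : (1 + ε) ^ (6 * n) ≤ 3 / 2)
    {E Q R : Matrix (Fin n) (Fin n) 𝕜} {π : Equiv.Perm (Fin n)} {v : Fin n → Fin n → 𝕜}
    {β : Fin n → ℝ} (h : IsPivotedQR ε E π v β R) (hQ : IsFormedQ ε v β Q) :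
    ∃ U ∈ Matrix.unitaryGroup (Fin n) 𝕜,
      frobNorm (U - Q) ≤ (1 + ε) ^ (94 * n ^ 3) - 1 ∧
      (∀ j, colNorm (U * R.submatrix id π.symm - E) j ≤
        ((1 + ε) ^ (94 * n ^ 3) - 1) * colNorm E j) ∧
      ∀ D X, IsComputedProduct ε v β Q D X → ∀ j,
        colNorm (U * X - D) j ≤ ((1 + ε) ^ (94 * n ^ 3) - 1) * colNorm D j := by
  obtain ⟨u, hu, hE⟩ := h.exists_isComputedReflector hε hn
  obtain ⟨U, hU, hUf⟩ := exists_mem_unitaryGroup_toLp_mulVec (reflectionProduct u)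
  have hsq : 93 * n ^ 2 ≤ 94 * n ^ 3 := by
    rcases n.eq_zero_or_pos with rfl | hpos
    · simp
    · exact Nat.mul_le_mul (by norm_num) (Nat.pow_le_pow_right hpos (by norm_num))
  have hformed (j : Fin n) : FlWithin ε (93 * n ^ 2) 1 (WithLp.toLp 2 (U.col j))
      (WithLp.toLp 2 (Q.col j)) := by
    have hcol := hUf (Pi.single j 1)
    rw [Matrix.mulVec_single_one] at hcol
    rw [hcol]
    exact hQ.flWithin_reflectionProduct hε hu j
  refine ⟨U, hU, ?_, fun j => FlWithin.colNorm_sub_le ?_,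
    fun D X hX j => FlWithin.colNorm_sub_le ?_⟩
  · have hcol (j : Fin n) : colNorm (U - Q) j ≤ (1 + ε) ^ (93 * n ^ 2) - 1 := by
      rw [colNorm_eq_norm]
      exact (norm_sub_rev _ _).trans_le ((hformed j).2.trans_eq (mul_one _))
    calc frobNorm (U - Q) ≤ n * ((1 + ε) ^ (93 * n ^ 2) - 1) :=
          frobNorm_le_card_mul (one_add_pow_sub_one_nonneg hε _) hcol
      _ ≤ (1 + ε) ^ (n * (93 * n ^ 2)) - 1 := mul_one_add_pow_sub_one_le hε _ _
      _ ≤ (1 + ε) ^ (94 * n ^ 3) - 1 :=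
          sub_le_sub_right (one_add_pow_mono hε (by nlinarith [(n ^ 3).zero_le])) 1
  · have hj := hE (π.symm j)
    rw [Equiv.apply_symm_apply, ← hUf] at hj
    exact hj.mono hε hsq
  · change FlWithin _ _ _ _ (WithLp.toLp 2 (U.mulVec (X.col j)))
    rw [hUf]
    rcases hX with hX | hX
    · exact (hX.flWithin hε (hQ.flWithin_reflectionProduct hε hu) j).mono hε
        (by nlinarith [n.le_mul_self])
    · exact (hX.flWithin_reflectionProduct hε hu j).mono hε hsq

end ColumnNorms

section ZeroEigenvalues

open Matrix Polynomial

theorem pow_card_dvd_det {ι S : Type*} [Fintype ι] [DecidableEq ι] [CommRing S]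
    {M : Matrix ι ι S} {p : S} {s : Finset ι} (h : ∀ i ∈ s, ∀ j, p ∣ M i j) :
    p ^ s.card ∣ M.det := by
  rw [← det_transpose, det_apply]
  refine Finset.dvd_sum fun σ _ => dvd_smul_of_dvd _ ?_
  rw [← Finset.prod_const]
  exact (Finset.prod_dvd_prod_of_dvd _ _ fun i hi => h i hi (σ i)).trans
    (Finset.prod_dvd_prod_of_subset _ _ _ (Finset.subset_univ s))

-- Constant unimodular factors diagonalise `P(0)`, and `X` divides the rows of the transformed `P`
-- in which the diagonal entry vanishes.
theorem X_pow_dvd_det {ι K : Type*} [Fintype ι] [DecidableEq ι] [Field K] (P : Matrix ι ι K[X]) :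
    X ^ (Fintype.card ι - (P.map (eval 0)).rank) ∣ P.det := by
  classical
  obtain ⟨L, L', d, hd⟩ :=
    Pivot.exists_list_transvec_mul_mul_list_transvec_eq_diagonal (P.map (eval 0))
  have hL := TransvectionStruct.det_toMatrix_prod L
  have hL' := TransvectionStruct.det_toMatrix_prod L'
  generalize (L.map TransvectionStruct.toMatrix).prod = U at hd hL
  generalize (L'.map TransvectionStruct.toMatrix).prod = V at hd hL'
  have hcard : Fintype.card ι - (P.map (eval 0)).rank = {i | d i = 0}.toFinset.card := by
    rw [← rank_mul_eq_right_of_isUnit_det U (P.map (eval 0)) (by simp [hL]),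
      ← rank_mul_eq_left_of_isUnit_det V _ (by simp [hL']), hd, rank_diagonal,
      Fintype.card_subtype_compl, Set.toFinset_card]
    exact Nat.sub_sub_self (Fintype.card_subtype_le _)
  set M : Matrix ι ι K[X] := C.mapMatrix U * P * C.mapMatrix V with hM
  have hM0 : M.map (eval 0) = diagonal d := by
    change (evalRingHom 0).mapMatrix M = _
    rw [hM, map_mul, map_mul, ← hd]
    congr 2 <;> ext <;> simp
  have hdet : M.det = P.det := by
    rw [hM, det_mul, det_mul, ← RingHom.map_det, ← RingHom.map_det, hL, hL', map_one, one_mul,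
      mul_one]
  rw [hcard, ← hdet]
  refine pow_card_dvd_det fun i hi j => ?_
  rw [X_dvd_iff, coeff_zero_eq_eval_zero, ← map_apply (f := eval 0), hM0]
  rcases eq_or_ne i j with rfl | hij
  · simpa using hi
  · exact diagonal_apply_ne d hij

theorem hasAtLeastZeroEigenvalues_sub_rank {𝕜 : Type*} [RCLike 𝕜] {n : ℕ}
    (P : Matrix (Fin n) (Fin n) 𝕜[X]) :
    HasAtLeastZeroEigenvalues (n - (P.map (eval 0)).rank) P := by
  refine ⟨by simpa using X_pow_dvd_det P, ?_⟩
  have rank_nullity := LinearMap.finrank_range_add_finrank_ker (toLin' (P.map (eval 0)))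
  rw [Module.finrank_fin_fun, toLin'_apply'] at rank_nullity
  rw [Matrix.rank, toLin'_apply']
  exact Nat.sub_le_iff_le_add'.2 rank_nullity.ge

theorem quartic_map_eval_zero {𝕜 : Type*} [RCLike 𝕜] {n : ℕ}
    (A B C D E : Matrix (Fin n) (Fin n) 𝕜) : (quartic A B C D E).map (eval 0) = E := by
  ext i j
  simp [quartic]

end ZeroEigenvalues

section Deflation

open Matrix

variable {𝕜 : Type*} [RCLike 𝕜] {n r : ℕ}

theorem firstCols_mul_apply (hr : r ≤ n) (F : Matrix (Fin r) (Fin n) 𝕜) (i j : Fin n) :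
    (firstCols 𝕜 hr * F) i j = if hi : (i : ℕ) < r then F ⟨i, hi⟩ j else 0 := by
  rw [mul_apply]
  split_ifs with hi
  · rw [Fintype.sum_eq_single ⟨i, hi⟩ fun b hb => ?_]
    · simp [firstCols, one_apply]
    · have : (i : ℕ) ≠ b := fun h => hb (Fin.ext h.symm)
      simp [firstCols, one_apply, Fin.ext_iff, this]
  · refine Finset.sum_eq_zero fun b _ => ?_
    have : (i : ℕ) ≠ b := fun h => hi (h ▸ b.2)
    simp [firstCols, one_apply, Fin.ext_iff, this]

theorem rank_firstCols_mul_firstRows (hr : r ≤ n) {R : Matrix (Fin n) (Fin n) 𝕜}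
    (hR : ∀ i j, j < i → R i j = 0) (hd : ∀ i : Fin n, (i : ℕ) < r → R i i ≠ 0) :
    (firstCols 𝕜 hr * firstRows hr R).rank = r := by
  refine le_antisymm ((rank_mul_le_right _ _).trans
    ((rank_le_card_height _).trans_eq (Fintype.card_fin r))) ?_
  have hminor : (firstCols 𝕜 hr * firstRows hr R).submatrix (Fin.castLE hr) (Fin.castLE hr) =
      R.submatrix (Fin.castLE hr) (Fin.castLE hr) := by
    ext i j
    simp [firstCols_mul_apply, firstRows]
  have htriangular : (R.submatrix (Fin.castLE hr) (Fin.castLE hr)).IsUpperTriangular :=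
    fun i j hij => hR _ _ hij
  have hunit : IsUnit (R.submatrix (Fin.castLE hr) (Fin.castLE hr)) := by
    rw [isUnit_iff_isUnit_det, det_of_isUpperTriangular htriangular, isUnit_iff_ne_zero]
    exact Finset.prod_ne_zero_iff.2 fun i _ => hd _ i.2
  calc r = (R.submatrix (Fin.castLE hr) (Fin.castLE hr)).rank := by
        rw [rank_of_isUnit _ hunit, Fintype.card_fin]
    _ ≤ (firstCols 𝕜 hr * firstRows hr R).rank := by
        rw [← hminor]
        exact rank_submatrix_le _ _ _

theorem transL_mul_linA_mul_transR {U : Matrix (Fin n) (Fin n) 𝕜}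
    (hU : U ∈ unitaryGroup (Fin n) 𝕜) (B D E : Matrix (Fin n) (Fin n) 𝕜) :
    transL U * linA B D E * transR U = linA B (Uᴴ * D) (Uᴴ * E) := by
  have hUU : Uᴴ * U = 1 := mem_unitaryGroup_iff'.1 hU
  simp [transL, linA, transR, fromBlocks_multiply, hUU, ← fromBlocks_one, fromBlocks_neg]

theorem transL_mul_linB_mul_transR {U : Matrix (Fin n) (Fin n) 𝕜}
    (hU : U ∈ unitaryGroup (Fin n) 𝕜) (A C : Matrix (Fin n) (Fin n) 𝕜) :
    transL U * linB A C * transR U = redB n A (Uᴴ * C) U := by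
  have hUU : Uᴴ * U = 1 := mem_unitaryGroup_iff'.1 hU
  simp [transL, linB, transR, redB, fromBlocks_multiply, hUU, ← fromBlocks_one, fromBlocks_neg]

theorem exists_linA_submatrix_splitIdx (hr : r ≤ n) (B X : Matrix (Fin n) (Fin n) 𝕜)
    (F : Matrix (Fin r) (Fin n) 𝕜) (π : Equiv.Perm (Fin n)) :
    ∃ S : Matrix ((Fin n ⊕ Fin n) ⊕ (Fin n ⊕ Fin r)) (Fin (n - r)) 𝕜,
      (linA B X ((firstCols 𝕜 hr * F).submatrix id π.symm)).submatrix (splitIdx hr) (splitIdx hr) =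
        fromBlocks (redA hr B X F π) S 0 0 := by
  have hF := firstCols_mul_apply hr F
  generalize firstCols 𝕜 hr * F = G at hF ⊢
  refine ⟨((linA B X (G.submatrix id π.symm)).submatrix (splitIdx hr) (splitIdx hr)).toBlocks₁₂,
    ext_iff_blocks.2 ⟨?_, rfl, ?_, ?_⟩⟩ <;>
  ext1 i j
  · rcases i with (i | i) | (i | i) <;> rcases j with (j | j) | (j | j) <;>
      simp [toBlocks₁₁, linA, splitIdx, redA, hF, firstCols, one_apply, Fin.ext_iff]
  · rcases j with (j | j) | (j | j) <;> simp [toBlocks₂₁, linA, splitIdx, hF]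
  · simp [toBlocks₂₂, linA, splitIdx]

theorem redB_submatrix_splitIdx (hr : r ≤ n) (A Y Q : Matrix (Fin n) (Fin n) 𝕜) :
    (redB n A Y Q).submatrix (splitIdx hr) (splitIdx hr) =
      fromBlocks (redB r A Y Q) 0 0 (-1) := by
  ext1 i j
  rcases i with ((i | i) | (i | i)) | i <;> rcases j with ((j | j) | (j | j)) | j <;>
    simp [splitIdx, redB, one_apply, Fin.ext_iff] <;> omega

theorem redB_add_deltaRedB (A Y Q δQ : Matrix (Fin n) (Fin n) 𝕜) :
    redB r A Y Q + deltaRedB r δQ = redB r A Y (Q + δQ) := by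
  simp [redB, deltaRedB, fromBlocks_add, add_comm]

theorem isExactReducedLinearization_of_mem_unitaryGroup (hr : r ≤ n)
    (A B X Y : Matrix (Fin n) (Fin n) 𝕜) (π : Equiv.Perm (Fin n)) {U R : Matrix (Fin n) (Fin n) 𝕜}
    (hU : U ∈ unitaryGroup (Fin n) 𝕜) (hR : ∀ i j, j < i → R i j = 0)
    (hd : ∀ i : Fin n, (i : ℕ) < r → R i i ≠ 0) :
    IsExactReducedLinearization hr A B (U * Y) (U * X)
      (U * (firstCols 𝕜 hr * firstRows hr R).submatrix id π.symm) π U (firstRows hr R)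
      (redA hr B X (firstRows hr R) π) (redB r A Y U) := by
  have hUU : Uᴴ * U = 1 := mem_unitaryGroup_iff'.1 hU
  have hdet : IsUnit U.det := (isUnit_iff_isUnit_det U).1 (IsUnit.of_mul_eq_one_right _ hUU)
  obtain ⟨S, hS⟩ := exists_linA_submatrix_splitIdx hr B X (firstRows hr R) π
  refine ⟨hU, fun i j hij => hR _ _ hij, ?_, ?_, S, 0, ?_, ?_⟩
  · rw [rank_mul_eq_right_of_isUnit_det _ _ hdet]
    exact (rank_submatrix _ (Equiv.refl _) π.symm).trans (rank_firstCols_mul_firstRows hr hR hd)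
  · ext i j
    simp [mul_apply]
  · rw [transL_mul_linA_mul_transR hU, ← mul_assoc, ← mul_assoc, hUU, one_mul, one_mul, hS]
  · rw [transL_mul_linB_mul_transR hU, ← mul_assoc, hUU, one_mul, redB_submatrix_splitIdx]

theorem IsExactReducedLinearization.hasAtLeastZeroEigenvalues {hr : r ≤ n}
    {A B C D E Q : Matrix (Fin n) (Fin n) 𝕜} {π : Equiv.Perm (Fin n)}
    {R : Matrix (Fin r) (Fin n) 𝕜}
    {A₂ B₂ : Matrix ((Fin n ⊕ Fin n) ⊕ (Fin n ⊕ Fin r)) ((Fin n ⊕ Fin n) ⊕ (Fin n ⊕ Fin r)) 𝕜}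
    (h : IsExactReducedLinearization hr A B C D E π Q R A₂ B₂) :
    HasAtLeastZeroEigenvalues (n - r) (quartic A B C D E) := by
  have hzero := hasAtLeastZeroEigenvalues_sub_rank (quartic A B C D E)
  rwa [quartic_map_eval_zero, h.2.2.1] at hzero

end Deflation

section Truncation

open Matrix

variable {𝕜 : Type*} [RCLike 𝕜] {n r : ℕ} {R : Matrix (Fin n) (Fin n) 𝕜} {τ κ : ℝ}

/-- The perturbation of `R` that annihilates its rows from index `r` on, that is, the truncation
error `ΔE` of the numerical rank `r` in the coordinates of the triangular factor. -/
def truncationError (hr : r ≤ n) (R : Matrix (Fin n) (Fin n) 𝕜) : Matrix (Fin n) (Fin n) 𝕜 :=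
  firstCols 𝕜 hr * firstRows hr R - R

theorem truncationError_apply (hr : r ≤ n) (R : Matrix (Fin n) (Fin n) 𝕜) (i j : Fin n) :
    truncationError hr R i j = if r ≤ (i : ℕ) then -R i j else 0 := by
  rw [truncationError, Matrix.sub_apply, firstCols_mul_apply]
  split_ifs <;> first | omega | simp [firstRows]

theorem mul_add_mul_truncationError (hr : r ≤ n) (U R : Matrix (Fin n) (Fin n) 𝕜)
    (π : Equiv.Perm (Fin n)) :
    U * R.submatrix id π.symm + U * (truncationError hr R).submatrix id π.symm =
      U * (firstCols 𝕜 hr * firstRows hr R).submatrix id π.symm := by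
  have hsplit : firstCols 𝕜 hr * firstRows hr R = R + truncationError hr R :=
    (add_sub_cancel R _).symm
  rw [hsplit, ← Matrix.mul_add]
  rfl

theorem truncationError_apply_of_lt (hr : r ≤ n) (hR : ∀ i j, j < i → R i j = 0) (i : Fin n)
    {j : Fin n} (hj : (j : ℕ) < r) : truncationError hr R i j = 0 := by
  rw [truncationError_apply]
  split_ifs with hi
  · rw [hR i j (Fin.lt_def.2 (hj.trans_le hi)), neg_zero]
  · rfl

theorem colNorm_truncationError (hr : r ≤ n) (R : Matrix (Fin n) (Fin n) 𝕜) (j : Fin n) :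
    colNorm (truncationError hr R) j = ‖restrictRows {i : Fin n | r ≤ (i : ℕ)} (R.col j)‖ := by
  have hcol : WithLp.toLp 2 ((truncationError hr R).col j) =
      -restrictRows {i : Fin n | r ≤ (i : ℕ)} (R.col j) := by
    ext i
    by_cases hi : r ≤ (i : ℕ) <;> simp [truncationError_apply, restrictRows, hi]
  rw [colNorm_eq_norm, hcol, norm_neg]

theorem IsNumericalRank.threshold_nonneg (h : IsNumericalRank τ R r) (h0 : r ≠ 0) (hr : r < n) :
    0 ≤ τ := by
  obtain ⟨-, hne, hdrop, -⟩ := h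
  obtain ⟨k, rfl⟩ := Nat.exists_eq_succ_of_ne_zero h0
  have hpos : 0 < ‖R ⟨k, by omega⟩ ⟨k, by omega⟩‖ := norm_pos_iff.2 (hne _ k.lt_succ_self)
  exact nonneg_of_mul_nonneg_left ((norm_nonneg _).trans (hdrop _ ⟨k + 1, hr⟩ rfl rfl)) hpos

-- Dominance of row `r` bounds the discarded part of column `j` by the first discarded diagonal
-- entry, the drop-off leads to the last retained one, and dominance of row `i` to column `i`.
theorem IsNumericalRank.colNorm_truncationError_le (h : IsNumericalRank τ R r) (hr : r ≤ n)
    (hκ : 0 ≤ κ) (hdom : ∀ i j, i ≤ j → ‖restrictRows (Set.Ici i) (R.col j)‖ ≤ κ * ‖R i i‖)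
    {i j : Fin n} (hi : (i : ℕ) < r) (hj : r ≤ (j : ℕ)) :
    colNorm (truncationError hr R) j ≤ κ ^ 2 * τ * colNorm R i := by
  have hτ := h.threshold_nonneg (by omega) (by omega)
  let p : Fin n := ⟨r - 1, by omega⟩
  let q : Fin n := ⟨r, by omega⟩
  have hdrop : ‖R q q‖ ≤ τ * ‖R p p‖ := h.2.2.1 p q (Nat.sub_add_cancel (by omega)) rfl
  have hip : i ≤ p := Fin.le_def.2 (Nat.le_sub_one_of_lt hi)
  have hp : ‖R p p‖ ≤ κ * ‖R i i‖ :=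
    (norm_apply_le_norm_restrictRows (Set.mem_Ici.2 hip) (R.col p)).trans (hdom i p hip)
  have hii : ‖R i i‖ ≤ colNorm R i := by
    rw [colNorm_eq_norm]
    exact PiLp.norm_apply_le (WithLp.toLp 2 (R.col i)) i
  calc colNorm (truncationError hr R) j = ‖restrictRows (Set.Ici q) (R.col j)‖ :=
        colNorm_truncationError hr R j
    _ ≤ κ * ‖R q q‖ := hdom q j (Fin.le_def.2 hj)
    _ ≤ κ * (τ * (κ * colNorm R i)) := by
        gcongr
        exact hdrop.trans (by gcongr; exact hp.trans (by gcongr))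
    _ = κ ^ 2 * τ * colNorm R i := by ring

theorem IsDiagDominant.norm_restrictRows_le (h : IsDiagDominant R)
    (hR : ∀ i j, j < i → R i j = 0) {i j : Fin n} (hij : i ≤ j) :
    ‖restrictRows (Set.Ici i) (R.col j)‖ ≤ ‖R i i‖ := by
  have hsupport : restrictRows (Set.Ici i) (R.col j) =
      restrictRows ((Finset.Icc i j : Finset (Fin n)) : Set (Fin n)) (R.col j) := by
    ext l
    rcases le_or_gt l j with hl | hl
    · simp [restrictRows, Set.indicator_apply, hl]
    · simp [restrictRows, Set.indicator_apply, hR l j hl]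
  rw [hsupport, norm_restrictRows_coe]
  exact Real.sqrt_le_iff.2 ⟨norm_nonneg _, h i j hij⟩

theorem IsNumericalRank.eq_zero (h : IsNumericalRank τ R 0)
    (hdom : ∀ i j, i ≤ j → ‖restrictRows (Set.Ici i) (R.col j)‖ ≤ κ * ‖R i i‖) : R = 0 := by
  ext i j
  have : NeZero n := ⟨i.pos.ne'⟩
  have hj := hdom 0 j (Fin.zero_le j)
  rw [h.2.2.2 rfl 0 rfl, norm_zero, mul_zero] at hj
  exact norm_le_zero_iff.1 ((norm_apply_le_norm_restrictRows (Set.mem_Ici.2 (Fin.zero_le i))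
    (R.col j)).trans hj)

end Truncation

section Constants

variable {n m N : ℕ} {ε : ℝ}

theorem one_add_pow_sub_one_le_two_mul (hε : 0 ≤ ε) (hm : m ≤ N) (hN : N * ε ≤ 1) :
    (1 + ε) ^ m - 1 ≤ 2 * (N * ε) := by
  have hexp : (1 + ε) ^ m ≤ Real.exp (N * ε) := by
    rw [Real.exp_nat_mul]
    exact (one_add_pow_mono hε hm).trans
      (pow_le_pow_left₀ (by linarith) (by linarith [Real.add_one_le_exp ε]) N)
  have hnonneg : 0 ≤ N * ε := by positivity
  have hquad := (abs_le.1 (Real.abs_exp_sub_one_sub_id_le (by rwa [abs_of_nonneg hnonneg]))).2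
  nlinarith

theorem one_add_pow_sub_one_le_cube (hε : 0 ≤ ε) (hm : m ≤ 222 * n ^ 3)
    (hc : 444 * (n : ℝ) ^ 3 * ε ≤ 1) : (1 + ε) ^ m - 1 ≤ 444 * (n : ℝ) ^ 3 * ε :=
  (one_add_pow_sub_one_le_two_mul hε hm (by push_cast; linarith)).trans_eq (by push_cast; ring)

theorem one_add_pow_le_three_halves (hε : 0 ≤ ε) (hc : 444 * (n : ℝ) ^ 3 * ε ≤ 1) :
    (1 + ε) ^ (6 * n) ≤ 3 / 2 := by
  have hm : 6 * n ≤ 6 * n ^ 3 := Nat.mul_le_mul_left 6 (Nat.le_self_pow three_ne_zero n)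
  have h := one_add_pow_sub_one_le_two_mul hε hm (by push_cast; linarith)
  push_cast at h
  linarith

theorem one_add_pow_sq_le (hε : 0 ≤ ε) (hc : 444 * (n : ℝ) ^ 3 * ε ≤ 1) :
    ((1 + ε) ^ (111 * n ^ 2)) ^ 2 ≤ 1 + 444 * (n : ℝ) ^ 3 * ε := by
  have hm : 111 * n ^ 2 * 2 ≤ 222 * n ^ 3 := by
    linarith [Nat.mul_le_mul_left n (Nat.le_self_pow two_ne_zero n)]
  rw [← pow_mul]
  exact sub_le_iff_le_add'.1 (one_add_pow_sub_one_le_cube hε hm hc)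

end Constants

theorem proposition1 (𝕜 : Type*) [RCLike 𝕜] :
    ∃ c : ℝ, 0 < c ∧
    ∀ (n : ℕ) (ε τ : ℝ), 0 ≤ ε → c * (n : ℝ) ^ 3 * ε ≤ 1 →
    ∀ (A B C D E : Matrix (Fin n) (Fin n) 𝕜)
      (π : Equiv.Perm (Fin n)) (v : Fin n → Fin n → 𝕜) (β : Fin n → ℝ)
      (Q R X Y : Matrix (Fin n) (Fin n) 𝕜) (r : ℕ) (hr : r ≤ n),
      IsPivotedQR ε E π v β R → IsFormedQ ε v β Q → IsNumericalRank τ R r →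
      IsComputedProduct ε v β Q D X → IsComputedProduct ε v β Q C Y →
    ∃ δQ δC δD δE ΔE : Matrix (Fin n) (Fin n) 𝕜,
      IsExactReducedLinearization hr A B (C + δC) (D + δD) (E + δE + ΔE)
        π (Q + δQ) (firstRows hr R)
        (redA hr B X (firstRows hr R) π) (redB r A Y Q + deltaRedB r δQ) ∧
      HasAtLeastZeroEigenvalues (n - r) (quartic A B (C + δC) (D + δD) (E + δE + ΔE)) ∧
      frobNorm δQ ≤ c * (n : ℝ) ^ 3 * ε ∧
      (∀ i, colNorm δC i ≤ c * (n : ℝ) ^ 3 * ε * colNorm C i) ∧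
      (∀ i, colNorm δD i ≤ c * (n : ℝ) ^ 3 * ε * colNorm D i) ∧
      (∀ i, colNorm δE i ≤ c * (n : ℝ) ^ 3 * ε * colNorm E i) ∧
      (∀ j : Fin n, (j : ℕ) < r → ∀ i, ΔE i (π j) = 0) ∧
      (∀ i j : Fin n, (i : ℕ) < r → r ≤ (j : ℕ) →
        colNorm ΔE (π j) ≤ (1 + c * (n : ℝ) ^ 3 * ε) * τ * colNorm (E + δE) (π i)) ∧
      (IsDiagDominant R → ∀ i j : Fin n, (i : ℕ) < r → r ≤ (j : ℕ) →
        colNorm ΔE (π j) ≤ τ * colNorm (E + δE) (π i)) ∧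
      (r = 0 → ΔE = 0) := by
  refine ⟨444, by norm_num, fun n ε τ hε hc A B C D E π v β Q R X Y r hr hqr hQ hrank hX hY => ?_⟩
  have hsmall := one_add_pow_le_three_halves hε hc
  have hκ := one_add_pow_sq_le hε hc
  obtain ⟨U, hU, hUQ, hUE, hUX⟩ := hqr.exists_unitary hε hsmall hQ
  have hR (i j : Fin n) (hij : j < i) : R i j = 0 := hqr.apply_eq_zero hij
  have hdom (i j : Fin n) (hij : i ≤ j) := hqr.norm_restrictRows_le hε hsmall hij
  have hbound := one_add_pow_sub_one_le_cube (m := 94 * n ^ 3) hε (by omega) hc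
  have hlin := isExactReducedLinearization_of_mem_unitaryGroup hr A B X Y π hU hR hrank.2.1
  refine ⟨U - Q, U * Y - C, U * X - D, U * R.submatrix id π.symm - E,
    U * (truncationError hr R).submatrix id π.symm, ?_⟩
  simp only [redB_add_deltaRedB, add_sub_cancel, mul_add_mul_truncationError,
    colNorm_unitary_mul_submatrix hU]
  refine ⟨hlin, hlin.hasAtLeastZeroEigenvalues, hUQ.trans hbound,
    fun i => (hUX C Y hY i).trans (by gcongr; exact colNorm_nonneg C i),
    fun i => (hUX D X hX i).trans (by gcongr; exact colNorm_nonneg D i),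
    fun i => (hUE i).trans (by gcongr; exact colNorm_nonneg E i),
    fun j hj i => ?_, fun i j hi hj => ?_, fun hdiag i j hi hj => ?_, ?_⟩
  · simp [Matrix.mul_apply, truncationError_apply_of_lt hr hR _ hj]
  · have hτ := hrank.threshold_nonneg (by omega) (by omega)
    have hnonneg := colNorm_nonneg R i
    exact (hrank.colNorm_truncationError_le hr (by positivity) hdom hi hj).trans (by gcongr)
  · simpa using hrank.colNorm_truncationError_le hr zero_le_one
      (fun i j hij => by simpa using hdiag.norm_restrictRows_le hR hij) hi hj
  · rintro rfl
    simp [truncationError, firstRows, hrank.eq_zero hdom]
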